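/- Let $A$ be a noetherian commutative ring, let $n \ge 0$, and let $f(u)=\sum_{i=0}^n a_{2n-2i}u^{2i}$ be a monic polynomial in $u^2$ with coefficients in $A$ (so $a_0=1$). Let $B = A[\eta_1,\dots,\eta_n]/I$ be the \emph{signed splitting ring} of $f$, where $I$ is the ideal generated by the coefficients (in $u$) of $f(u)-\prod_{i=1}^n(u^2-\eta_i^2)$. Put $\tilde f(v)=\sum_{i=0}^n a_{2n-2i}v^i$, so that $\tilde f(u^2)=f(u)$, and let $\Delta=(-4)^n a_{2n}\operatorname{disc}(\tilde f)\in A$; in $B$ one has $\Delta = 4^n\,\eta_1^2\cdots\eta_n^2\prod_{i<j}(\eta_i^2-\eta_j^2)^2$. A ring is \emph{normal} if its localizations at all prime ideals are integrally closed domains. An element $x$ of a normal noetherian ring $R$ is \emph{squarefree} if $v_{\mathfrak p}(x)\in\{0,1\}$ for every height one prime $\mathfrak p$ of $R$, where $v_{\mathfrak p}$ is the valuation of the discrete valuation ring $R_{\mathfrak p}$ (with $v_{\mathfrak p}(0)=\infty$). A subset of $\operatorname{Spec}(A)$ has \emph{codimension $\ge c$} if all primes it contains have height $\ge c$. Let $\overline{E}\subset\operatorname{Spec}(B)$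 be the locus where at least two of the following $n+\binom n2$ equations hold: $\eta_i=0$ for $1\le i\le n$, and $\eta_i^2=\eta_j^2$ for $1\le i<j\le n$. Let $E\subset\operatorname{Spec}(A)$ be the image of $\overline{E}$. Let $V(\Delta,\partial\Delta)\subset\operatorname{Spec}(A)$ be the set of points $x$ such that the image of $\Delta$ in the local ring $A_x$ lies in $\mathfrak m_x^2$, where $\mathfrak m_x$ is the maximal ideal of $A_x$. (1) Suppose that $A$ is normal, that $\Delta$ is squarefree and a non-zerodivisor, and that $E$ has codimension $\ge 2$ in $\operatorname{Spec}(A)$. Then $B$ is normal. (2) Suppose that $A$ is normal, that $\Delta$ is a non-zerodivisor, and that $V(\Delta,\partial\Delta)$ has codimension $\ge 2$ in $\operatorname{Spec}(A)$. Then $\Delta$ is squarefree and $B$ is normal. -/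

import Mathlib

open Polynomial

noncomputable section

namespace SignedSplit

universe u

variable {A : Type u} [CommRing A]

/-! ### Normal rings, order of vanishing, codimension -/

/-- A commutative ring is normal if all its localizations at primes are integrally closed
domains. -/
def IsNormalRing (R : Type u) [CommRing R] : Prop :=
  ∀ p : PrimeSpectrum R, IsDomain (Localization.AtPrime p.asIdeal) ∧
    IsIntegrallyClosed (Localization.AtPrime p.asIdeal)

/-- The largest `k` with `x ∈ 𝔪ᵏ` (possibly `∞`) in a local ring. -/
def localOrder {R : Type u} [CommRing R] [IsLocalRing R] (x : R) : ℕ∞ :=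
  ⨆ (k : ℕ) (_ : x ∈ IsLocalRing.maximalIdeal R ^ k), (k : ℕ∞)

/-- In a discrete valuation ring, `localOrder` is the normalized valuation. -/
theorem localOrder_eq_addVal {R : Type u} [CommRing R] [IsDomain R] [IsDiscreteValuationRing R]
    (x : R) : localOrder x = IsDiscreteValuationRing.addVal R x := by
  obtain ⟨ϖ, hϖ⟩ := IsDiscreteValuationRing.exists_irreducible R
  have key : ∀ k : ℕ, x ∈ IsLocalRing.maximalIdeal R ^ k ↔
      (k : ℕ∞) ≤ IsDiscreteValuationRing.addVal R x := by
    intro k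
    rw [hϖ.maximalIdeal_eq, Ideal.span_singleton_pow, Ideal.mem_span_singleton,
      ← IsDiscreteValuationRing.addVal_le_iff_dvd, hϖ.addVal_pow]
  unfold localOrder
  apply le_antisymm
  · exact iSup₂_le fun k hk => (key k).1 hk
  · refine ENat.forall_natCast_le_iff_le.1 fun k hk => ?_
    exact le_iSup₂_of_le k ((key k).2 hk) le_rfl

/-- The order of vanishing `v_𝔭(x)` of `x` at `𝔭`; it is the valuation attached to `𝔭` when the
localization at `𝔭` is a discrete valuation ring, with `v_𝔭(0) = ∞`. -/
def primeOrder (p : PrimeSpectrum A) (x : A) : ℕ∞ :=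
  localOrder (algebraMap A (Localization.AtPrime p.asIdeal) x)

/-- An element (of a normal ring) is squarefree if its valuation at every prime of height one is
`0` or `1`. -/
def IsSquarefreeElt (x : A) : Prop :=
  ∀ p : PrimeSpectrum A, p.asIdeal.height = 1 → primeOrder p x = 0 ∨ primeOrder p x = 1

/-- A subset of `Spec A` has codimension `≥ c` if all primes it contains have height `≥ c`. -/
def CodimGE (S : Set (PrimeSpectrum A)) (c : ℕ) : Prop :=
  ∀ p ∈ S, (c : ℕ∞) ≤ p.asIdeal.height

/-- `V(x, ∂x)`: the set of points `p` of `Spec A` at which `x` vanishes to order two, i.e. the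
image of `x` in the local ring at `p` lies in the square of the maximal ideal. -/
def secondOrderLocus (x : A) : Set (PrimeSpectrum A) :=
  {p | algebraMap A (Localization.AtPrime p.asIdeal) x ∈
    IsLocalRing.maximalIdeal (Localization.AtPrime p.asIdeal) ^ 2}

/-! ### The signed splitting ring -/

/-- `f(u) = ∑_{i=0}^n a_{2n-2i} u^{2i}`. Only the values `a 0, a 2, …, a (2n)` matter. -/
def evenPoly (n : ℕ) (a : ℕ → A) : A[X] :=
  ∑ i ∈ Finset.range (n + 1), C (a (2 * n - 2 * i)) * X ^ (2 * i)

/-- `f̃(v) = ∑_{i=0}^n a_{2n-2i} v^i`, so that `f̃(u²) = f(u)`. -/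
def halfPoly (n : ℕ) (a : ℕ → A) : A[X] :=
  ∑ i ∈ Finset.range (n + 1), C (a (2 * n - 2 * i)) * X ^ i

/-- The ideal of `A[η₁, …, ηₙ]` generated by the coefficients (in `u`) of
`f(u) - ∏ (u² - ηᵢ²)`. -/
def relIdeal (n : ℕ) (a : ℕ → A) : Ideal (MvPolynomial (Fin n) A) :=
  Ideal.span (Set.range fun k : ℕ =>
    ((evenPoly n a).map (MvPolynomial.C : A →+* MvPolynomial (Fin n) A) -
      ∏ i : Fin n, (X ^ 2 - C (MvPolynomial.X i ^ 2))).coeff k)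

/-- The signed splitting ring of `f = ∑ a_{2n-2i} u^{2i}`. -/
def SSplit (n : ℕ) (a : ℕ → A) : Type u :=
  MvPolynomial (Fin n) A ⧸ relIdeal n a

instance SSplit.instCommRing (n : ℕ) (a : ℕ → A) : CommRing (SSplit n a) :=
  inferInstanceAs (CommRing (MvPolynomial (Fin n) A ⧸ relIdeal n a))

instance SSplit.instAlgebra (n : ℕ) (a : ℕ → A) : Algebra A (SSplit n a) :=
  inferInstanceAs (Algebra A (MvPolynomial (Fin n) A ⧸ relIdeal n a))

/-- The quotient map `A[η₁, …, ηₙ] → B`. -/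
def mkHom (n : ℕ) (a : ℕ → A) : MvPolynomial (Fin n) A →ₐ[A] SSplit n a :=
  Ideal.Quotient.mkₐ A (relIdeal n a)

/-- The generator `ηᵢ` of the signed splitting ring. -/
def eta (n : ℕ) (a : ℕ → A) (i : Fin n) : SSplit n a :=
  mkHom n a (MvPolynomial.X i)

/-- `Δ = (-4)ⁿ a_{2n} disc(f̃)`; see `algebraMap_Delta` for the expression
`4ⁿ ∏ ηᵢ² ∏_{i<j} (ηᵢ² - ηⱼ²)²` in terms of the roots. -/
def Delta (n : ℕ) (a : ℕ → A) : A :=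
  (-4) ^ n * a (2 * n) * (halfPoly n a).discr

theorem expand_halfPoly (n : ℕ) (a : ℕ → A) : expand A 2 (halfPoly n a) = evenPoly n a := by
  simp [halfPoly, evenPoly, pow_mul]

/-- The defining factorization `f(u) = ∏ (u² - ηᵢ²)` over the signed splitting ring. -/
theorem map_evenPoly (n : ℕ) (a : ℕ → A) :
    (evenPoly n a).map (algebraMap A (SSplit n a)) =
      ∏ i : Fin n, (X ^ 2 - C (eta n a i ^ 2)) := by
  have h : ((evenPoly n a).map (MvPolynomial.C : A →+* MvPolynomial (Fin n) A) -
      ∏ i : Fin n, (X ^ 2 - C (MvPolynomial.X i ^ 2))).map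
        (mkHom n a : MvPolynomial (Fin n) A →+* SSplit n a) = 0 := by
    ext k
    rw [coeff_map, coeff_zero]
    exact Ideal.Quotient.eq_zero_iff_mem.2 (Ideal.subset_span ⟨k, rfl⟩)
  rw [Polynomial.map_sub, sub_eq_zero, Polynomial.map_map, Polynomial.map_prod] at h
  have hc : (mkHom n a : MvPolynomial (Fin n) A →+* SSplit n a).comp MvPolynomial.C =
      algebraMap A (SSplit n a) := (mkHom n a).comp_algebraMap
  rw [hc] at h
  rw [h]
  simp [eta]

theorem map_halfPoly (n : ℕ) (a : ℕ → A) :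
    (halfPoly n a).map (algebraMap A (SSplit n a)) = ∏ i : Fin n, (X - C (eta n a i ^ 2)) := by
  apply expand_injective (n := 2) (by norm_num)
  rw [← map_expand, expand_halfPoly, map_evenPoly, map_prod]
  refine Finset.prod_congr rfl fun i _ => ?_
  rw [map_sub, expand_X, expand_C]

theorem halfPoly_monic (n : ℕ) (a : ℕ → A) (ha : a 0 = 1) : (halfPoly n a).Monic := by
  unfold halfPoly
  rw [Finset.sum_range_succ, add_comm]
  simp only [Nat.sub_self, ha, map_one, one_mul]
  refine monic_X_pow_add ?_
  refine (degree_sum_le _ _).trans_lt ?_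
  refine (Finset.sup_lt_iff (WithBot.bot_lt_coe n)).2 fun i hi => ?_
  exact (degree_C_mul_X_pow_le _ _).trans_lt (WithBot.coe_lt_coe.2 (Nat.cast_lt.2 (Finset.mem_range.1 hi)))

theorem discr_map_of_monic {R S : Type*} [CommRing R] [CommRing S] [Nontrivial S] (φ : R →+* S)
    {g : R[X]} (hg : g.Monic) : (g.map φ).discr = φ g.discr := by
  have hR : Nontrivial R := φ.domain_nontrivial
  by_cases h0 : g.natDegree = 0
  · rw [hg.natDegree_eq_zero.1 h0, Polynomial.map_one, ← C_1, ← C_1, discr_C, discr_C, map_one]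
  have hd : 0 < g.degree := natDegree_pos_iff_degree_pos.1 (Nat.pos_of_ne_zero h0)
  have hnd : (g.map φ).natDegree = g.natDegree := hg.natDegree_map φ
  have hd' : 0 < (g.map φ).degree :=
    natDegree_pos_iff_degree_pos.1 (by rw [hnd]; exact Nat.pos_of_ne_zero h0)
  have e1 := congrArg φ (resultant_deriv hd)
  have e2 := resultant_deriv hd'
  rw [hnd, derivative_map, resultant_map_map, e1, hg.leadingCoeff, (hg.map φ).leadingCoeff] at e2
  simp only [map_mul, map_pow, map_neg, map_one, mul_one] at e2
  have hu : IsUnit ((-1 : S) ^ (g.natDegree * (g.natDegree - 1) / 2)) := isUnit_one.neg.pow _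
  exact (hu.mul_left_cancel e2).symm

theorem discr_prod_X_sub_C {S : Type*} [CommRing S] [Nontrivial S] (n : ℕ) (r : Fin n → S) :
    (∏ i, (X - C (r i))).discr = ∏ i, ∏ j ∈ Finset.Ioi i, (r i - r j) ^ 2 := by
  rcases Nat.eq_zero_or_pos n with rfl | hn
  · rw [Finset.univ_eq_empty, Finset.prod_empty, Finset.prod_empty, ← C_1, discr_C]
  set g : S[X] := ∏ i, (X - C (r i)) with hgdef
  have hg : g.Monic := monic_prod_of_monic _ _ fun i _ => monic_X_sub_C _
  have hnd : g.natDegree = n := by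
    rw [hgdef, natDegree_prod_of_monic _ _ fun i _ => monic_X_sub_C _]; simp
  have hd : 0 < g.degree := natDegree_pos_iff_degree_pos.1 (by omega)
  have e := resultant_deriv hd
  have hder : g.derivative.natDegree ≤ n - 1 := by
    rw [← hnd]; exact natDegree_derivative_le g
  have e3 : g.resultant g.derivative g.natDegree (n - 1) =
      ∏ i, (X - C (r i)).resultant g.derivative (X - C (r i)).natDegree (n - 1) :=
    resultant_prod_left Finset.univ (fun i => X - C (r i)) g.derivative (n - 1) (by simp) hder
  have e4 : ∀ i, g.derivative.eval (r i) = ∏ j ∈ Finset.univ.erase i, (r i - r j) := by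
    intro i
    rw [hgdef, derivative_prod_finset, eval_finsetSum, Finset.sum_eq_single i]
    · simp [eval_prod]
    · intro j _ hji
      rw [eval_mul, eval_prod, Finset.prod_eq_zero (i := i) (by simp [Ne.symm hji]) (by simp),
        zero_mul]
    · simp
  have e5 : ∏ i, ∏ j ∈ Finset.univ.erase i, (r i - r j) =
      (-1) ^ (n * (n - 1) / 2) * ∏ i, ∏ j ∈ Finset.Ioi i, (r i - r j) ^ 2 := by
    have h1 : ∏ i : Fin n, ∏ j ∈ Finset.univ.erase i, (r i - r j) =
        ∏ i, ∏ j ∈ Finset.Ioi i, ((r i - r j) * (r j - r i)) := by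
      rw [Finset.prod_prod_Ioi_mul_eq_prod_prod_off_diag (fun i j => r j - r i)]
      simp only [Finset.compl_eq_univ_sdiff, Finset.sdiff_singleton_eq_erase]
    have h2 : ∀ i j, (r i - r j) * (r j - r i) = (-1) * (r i - r j) ^ 2 := by
      intro i j; ring
    simp_rw [h1, h2, Finset.prod_mul_distrib, Finset.prod_const, Finset.prod_pow_eq_pow_sum]
    congr 2
    simp only [Fin.card_Ioi]
    rw [Fin.sum_univ_eq_sum_range (fun i => n - 1 - i), Finset.sum_range_reflect (fun i => i),
      Finset.sum_range_id]
  simp only [natDegree_X_sub_C, resultant_X_sub_C_left _ _ _ hder, e4] at e3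
  rw [hnd] at e e3
  rw [e3, e5, hg.leadingCoeff, mul_one] at e
  have hu : IsUnit ((-1 : S) ^ (n * (n - 1) / 2)) := isUnit_one.neg.pow _
  exact (hu.mul_left_cancel e).symm

/-- In the signed splitting ring, `Δ = 4ⁿ ∏ ηᵢ² ∏_{i<j} (ηᵢ² - ηⱼ²)²`. -/
theorem algebraMap_Delta (n : ℕ) (a : ℕ → A) (ha : a 0 = 1) :
    algebraMap A (SSplit n a) (Delta n a) =
      4 ^ n * (∏ i, eta n a i ^ 2) *
        ∏ i, ∏ j ∈ Finset.Ioi i, (eta n a i ^ 2 - eta n a j ^ 2) ^ 2 := by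
  rcases subsingleton_or_nontrivial (SSplit n a) with h | h
  · exact Subsingleton.elim _ _
  have h0 : algebraMap A (SSplit n a) (a (2 * n)) = (-1) ^ n * ∏ i, eta n a i ^ 2 := by
    have h1 := congrArg (fun g => coeff g 0) (map_halfPoly n a)
    rw [coeff_map, coeff_zero_eq_eval_zero, coeff_zero_eq_eval_zero, eval_prod] at h1
    have h2 : (halfPoly n a).eval 0 = a (2 * n) := by
      simp [halfPoly, eval_finsetSum, Finset.sum_range_succ']
    rw [h2] at h1
    rw [h1]
    simp [Finset.prod_neg]
  have h3 : (-4 : SSplit n a) ^ n * (-1) ^ n = 4 ^ n := by rw [← mul_pow]; norm_num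
  rw [Delta, map_mul, map_mul, h0, ← discr_map_of_monic _ (halfPoly_monic n a ha), map_halfPoly,
    discr_prod_X_sub_C, ← h3]
  simp only [map_pow, map_neg, map_ofNat]
  ring

/-- The `n + n(n-1)/2` functions `ηᵢ` and `ηᵢ² - ηⱼ²` (`i < j`) on `Spec B`. -/
def coincidence (n : ℕ) (a : ℕ → A) :
    Fin n ⊕ {p : Fin n × Fin n // p.1 < p.2} → SSplit n a
  | Sum.inl i => eta n a i
  | Sum.inr p => eta n a p.1.1 ^ 2 - eta n a p.1.2 ^ 2

/-- The locus `Ē` in `Spec B` where at least two of the functions `coincidence` vanish. -/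
def upperLocus (n : ℕ) (a : ℕ → A) : Set (PrimeSpectrum (SSplit n a)) :=
  {q | ∃ s t, s ≠ t ∧ coincidence n a s ∈ q.asIdeal ∧ coincidence n a t ∈ q.asIdeal}

/-- The locus `E`, the image of `Ē` in `Spec A`. -/
def lowerLocus (n : ℕ) (a : ℕ → A) : Set (PrimeSpectrum A) :=
  PrimeSpectrum.comap (algebraMap A (SSplit n a)) '' upperLocus n a

end SignedSplit

end

/-!
`B` is finite free over `A`, so a fraction of `B` that is integral at all primes of `B` lying over
primes of height one of `A` is integral everywhere; hence normality of `B` can be tested at those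
primes. Let `q` be one of them, lying over `p`. The differential of the factorization of `f` shows
that `Δ` annihilates `Ω[B⁄A]`. If `Δ ∉ p`, then `B` is unramified over the discrete valuation ring
`A_p` at `q`. Otherwise `Δ` is a uniformizer of `A_p` and exactly one of `ηᵢ = 0`, `ηᵢ² = ηⱼ²` holds
at `q`. The corresponding one of `ηᵢ`, `ηᵢ - ηⱼ`, `ηᵢ + ηⱼ` divides `Δ`, and dividing by it makes
`B` unramified at `q`, so it generates the maximal ideal of `B_q`.

For the second criterion, `disc f̃` is the determinant of the matrix of power sums `VᵀV`, where `V`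
is the Vandermonde matrix of the `ηᵢ²`. Where two coincidences `ηᵢ² = ηⱼ²` occur, the first minors
of `V` vanish, hence so do those of `VᵀV`, and a determinant all of whose first minors lie in the
maximal ideal lies in its square.
-/

namespace SignedSplit

open scoped nonZeroDivisors
open IsLocalRing (maximalIdeal)
open KaehlerDifferential (D)

universe u v

/-! ### Normal domains -/

/-- An integrally closed domain. `IsNormalRing R` says that every localization of `R` at a prime
has this property. -/
def IsNormalDomain (R : Type*) [CommRing R] : Prop :=
  IsDomain R ∧ IsIntegrallyClosed R

theorem IsNormalDomain.of_ringEquiv {R S : Type*} [CommRing R] [CommRing S] (e : R ≃+* S)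
    (h : IsNormalDomain R) : IsNormalDomain S := by
  obtain ⟨_, _⟩ := h
  exact ⟨e.symm.toMulEquiv.isDomain _, .of_equiv e⟩

theorem isNormalDomain_localization_iff_of_comap_eq {B : Type*} [CommRing B] {M : Submonoid B}
    {Q : Ideal B} [Q.IsPrime] {Q₀ : Ideal (Localization M)} [Q₀.IsPrime]
    (h : Q₀.comap (algebraMap B (Localization M)) = Q) :
    IsNormalDomain (Localization.AtPrime Q) ↔ IsNormalDomain (Localization.AtPrime Q₀) := by
  subst h
  let e := (IsLocalization.localizationLocalizationAtPrimeIsoLocalization M Q₀).toRingEquiv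
  exact ⟨.of_ringEquiv e, .of_ringEquiv e.symm⟩

theorem isNormalDomain_of_maximalIdeal_eq_span {R : Type*} [CommRing R] [IsNoetherianRing R]
    [IsLocalRing R] {g : R} (hg : g ∈ R⁰) (h : maximalIdeal R = Ideal.span {g}) :
    IsNormalDomain R := by
  obtain ⟨P, hP⟩ := Ideal.nonempty_minimalPrimes (R := R) (I := ⊥) bot_ne_top
  have hgP : g ∉ P := fun hgP =>
    Set.disjoint_left.1 (Ideal.disjoint_nonZeroDivisors_of_mem_minimalPrimes hP) hgP hg
  have hP_le : P ≤ maximalIdeal R • P := fun x hx => by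
    obtain ⟨y, rfl⟩ :=
      Ideal.mem_span_singleton.1 (h ▸ IsLocalRing.le_maximalIdeal hP.1.1.ne_top hx)
    have hy : y ∈ P := (hP.1.1.mem_or_mem hx).resolve_left hgP
    exact Ideal.mul_mem_mul (h ▸ Ideal.mem_span_singleton_self g) hy
  have hP_bot : P = ⊥ := Submodule.eq_bot_of_le_smul_of_le_jacobson_bot _ P
    (IsNoetherian.noetherian P) hP_le (IsLocalRing.maximalIdeal_le_jacobson ⊥)
  have : (⊥ : Ideal R).IsPrime := hP_bot ▸ hP.1.1
  have : IsDomain R := IsDomain.of_bot_isPrime R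
  have hprincipal : (maximalIdeal R).IsPrincipal := ⟨g, h⟩
  exact ⟨this, (((tfae_of_isNoetherianRing_of_isLocalRing_of_isDomain R).out 4 3 rfl rfl).1
    hprincipal).1⟩

theorem exists_maximalIdeal_eq_span_of_height_eq_one {R : Type*} [CommRing R] [IsNoetherianRing R]
    [IsLocalRing R] [IsDomain R] [IsIntegrallyClosed R] (h : (maximalIdeal R).height = 1) :
    ∃ π, maximalIdeal R = Ideal.span {π} := by
  have eq_maximalIdeal (P : Ideal R) (hP : P ≠ ⊥) (hPp : P.IsPrime) : P = maximalIdeal R := by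
    by_contra hne
    have hlt := Ideal.height_strict_mono_of_isPrime_of_isPrime
      (lt_of_le_of_ne (IsLocalRing.le_maximalIdeal hPp.ne_top) hne)
    rw [h, Order.lt_one_iff, Ideal.height_eq_zero_iff_eq_bot] at hlt
    exact hP hlt
  obtain ⟨⟨π, hπ⟩⟩ := ((tfae_of_isNoetherianRing_of_isLocalRing_of_isDomain R).out 3 4 rfl rfl).1
    ⟨inferInstance, eq_maximalIdeal⟩
  exact ⟨π, hπ⟩

theorem ne_zero_of_maximalIdeal_eq_span {R : Type*} [CommRing R] [IsDomain R] [IsLocalRing R]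
    {π : R} (hπ : maximalIdeal R = Ideal.span {π}) (h : (maximalIdeal R).height = 1) : π ≠ 0 := by
  rintro rfl
  rw [hπ, Ideal.span_singleton_zero, Ideal.height_bot] at h
  exact zero_ne_one h

theorem maximalIdeal_eq_span_of_notMem_sq {R : Type*} [CommRing R] [IsDomain R] [IsLocalRing R]
    {π x : R} (hπ : maximalIdeal R = Ideal.span {π}) (hx : x ∈ maximalIdeal R)
    (hx2 : x ∉ maximalIdeal R ^ 2) : maximalIdeal R = Ideal.span {x} := by
  obtain ⟨u, rfl⟩ := Ideal.mem_span_singleton'.1 (hπ ▸ hx)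
  have hu : IsUnit u := by
    by_contra hu
    exact hx2 (pow_two (maximalIdeal R) ▸
      Ideal.mul_mem_mul hu (hπ ▸ Ideal.mem_span_singleton_self π))
  rw [Ideal.span_singleton_mul_left_unit hu, hπ]

/-! ### Finite free algebras that are normal in codimension one -/

section AssociatedPrime

variable {A : Type*} [CommRing A] [IsDomain A] [IsNoetherianRing A] [IsIntegrallyClosed A]
  {s x : A}

/-- Otherwise multiplication by `x / s` maps the faithful finite module `p` to itself, so that
`x / s` is integral over `A`. -/
theorem exists_mul_eq_mul_notMem (hs : s ≠ 0) {p : Ideal A} (hp : p ≠ ⊥) (hx : ¬ s ∣ x)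
    (h : ∀ a ∈ p, s ∣ a * x) : ∃ a ∈ p, ∃ b ∉ p, a * x = s * b := by
  by_contra! hcon
  let K := FractionRing A
  have hsK : algebraMap A K s ≠ 0 := by simpa using hs
  have hint : IsIntegral A (algebraMap A K x / algebraMap A K s) := by
    refine isIntegral_of_smul_mem_submodule (M := K) (Submodule.map (Algebra.linearMap A K) p) ?_
      ((IsNoetherian.noetherian p).map _) _ ?_
    · exact fun e => hp (Submodule.map_injective_of_injective
        (FaithfulSMul.algebraMap_injective A K) (e.trans (Submodule.map_bot _).symm))
    · rintro _ ⟨a, ha, rfl⟩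
      obtain ⟨b, hb⟩ := h a ha
      refine ⟨b, by_contra fun hbp => hcon a ha b hbp hb, ?_⟩
      rw [Algebra.linearMap_apply, Algebra.linearMap_apply, smul_eq_mul, div_mul_eq_mul_div,
        eq_div_iff hsK, ← map_mul, ← map_mul, mul_comm x, hb, mul_comm]
  obtain ⟨y, hy⟩ := IsIntegrallyClosed.isIntegral_iff.1 hint
  rw [eq_div_iff hsK, ← map_mul] at hy
  exact hx ⟨y, by rw [← FaithfulSMul.algebraMap_injective A K hy, mul_comm]⟩

theorem height_eq_one_of_forall_mem_iff_dvd (hs : s ≠ 0) {p : Ideal A} [hp : p.IsPrime]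
    (h : ∀ a, a ∈ p ↔ s ∣ a * x) : p.height = 1 := by
  have hbot : p ≠ ⊥ := fun e => hs (by simpa [e] using (h s).2 (dvd_mul_right s x))
  refine le_antisymm ?_ (by rwa [Order.one_le_iff_ne_zero, Ne, Ideal.height_eq_zero_iff_eq_bot])
  have hx : ¬ s ∣ x := fun hx => hp.one_notMem ((h 1).2 (by rwa [one_mul]))
  obtain ⟨a, hap, b, hbp, hab⟩ := exists_mul_eq_mul_notMem hs hbot hx fun a ha => (h a).1 ha
  refine Ideal.height_le_one_of_isPrincipal_of_mem_minimalPrimes (Ideal.span {a}) p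
    ⟨⟨hp, (Ideal.span_singleton_le_iff_mem _).2 hap⟩, ?_⟩
  rintro q ⟨hq, haq⟩ hqp c hc
  obtain ⟨d, hd⟩ := (h c).1 hc
  have hcb : c * b = a * d := mul_left_cancel₀ hs (by linear_combination (-c) * hab + a * hd)
  have hcbq : c * b ∈ q := hcb ▸ q.mul_mem_right d ((Ideal.span_singleton_le_iff_mem _).1 haq)
  exact (hq.mem_or_mem hcbq).resolve_right fun hb => hbp (hqp hb)

theorem exists_isPrime_height_eq_one_of_not_dvd (hs : s ≠ 0) (hx : ¬ s ∣ x) :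
    ∃ p : Ideal A, p.IsPrime ∧ p.height = 1 ∧ ∀ a, s ∣ a * x → a ∈ p := by
  have colon_mk (y a : A) :
      a ∈ (⊥ : Submodule A (A ⧸ Ideal.span {s})).colon {Ideal.Quotient.mk _ y} ↔ s ∣ a * y := by
    rw [Submodule.mem_colon_singleton, Submodule.mem_bot, Algebra.smul_def,
      Ideal.Quotient.algebraMap_eq, ← map_mul, Ideal.Quotient.eq_zero_iff_mem,
      Ideal.mem_span_singleton]
  obtain ⟨p, hp, hxp⟩ := exists_le_isAssociatedPrime_of_isNoetherianRing A
    (Ideal.Quotient.mk (Ideal.span {s}) x)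
    (by rwa [Ne, Ideal.Quotient.eq_zero_iff_mem, Ideal.mem_span_singleton])
  obtain ⟨hpp, m, rfl⟩ := (Submodule.isAssociatedPrime_iff (N := ⊥)).1 hp
  obtain ⟨y, rfl⟩ := Ideal.Quotient.mk_surjective m
  exact ⟨_, hpp, height_eq_one_of_forall_mem_iff_dvd hs (colon_mk y),
    fun a ha => hxp ((colon_mk x a).2 ha)⟩

end AssociatedPrime

section CodimensionOne

variable {A B : Type*} [CommRing A] [CommRing B] [Algebra A B]

theorem algebraMap_dvd_iff_forall_dvd_repr {ι : Type*} [Finite ι] (β : Module.Basis ι A B) {s : A}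
    {c : B} : algebraMap A B s ∣ c ↔ ∀ i, s ∣ β.repr c i := by
  constructor
  · rintro ⟨b, rfl⟩ i
    rw [← Algebra.smul_def, map_smul]
    exact dvd_mul_right s _
  · intro h
    choose d hd using h
    refine ⟨β.equivFun.symm d, β.equivFun.injective ?_⟩
    rw [← Algebra.smul_def, map_smul, LinearEquiv.apply_symm_apply]
    exact funext hd

theorem algebraMapSubmonoid_nonZeroDivisors_le [Module.Flat A B] :
    Algebra.algebraMapSubmonoid B A⁰ ≤ B⁰ := by
  rintro _ ⟨s, hs, rfl⟩
  have hreg := Module.Flat.isSMulRegular_of_nonZeroDivisors (M := B) hs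
  refine mem_nonZeroDivisors_iff_right.2 fun b hb => hreg ?_
  simpa only [Algebra.smul_def, mul_comm b, mul_zero] using hb

theorem exists_isPrime_height_comap_eq_one_of_not_dvd [IsDomain A] [IsNoetherianRing A]
    [IsIntegrallyClosed A] [Module.Free A B] [Module.Finite A B] {s : A} (hs : s ≠ 0) {c : B}
    (hc : ¬ algebraMap A B s ∣ c) :
    ∃ Q : Ideal B, Q.IsPrime ∧ (Q.comap (algebraMap A B)).height = 1 ∧
      ∀ b, algebraMap A B s ∣ b * c → b ∈ Q := by
  let β := Module.Free.chooseBasis A B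
  obtain ⟨i, hi⟩ := not_forall.1 (mt (algebraMap_dvd_iff_forall_dvd_repr β).2 hc)
  obtain ⟨p, hp, hheight, hsp⟩ := exists_isPrime_height_eq_one_of_not_dvd hs hi
  let J : Ideal B := Submodule.comap (LinearMap.mulRight B c) (Ideal.span {algebraMap A B s})
  have mem_J (b : B) : b ∈ J ↔ algebraMap A B s ∣ b * c := Ideal.mem_span_singleton
  have hJp : J.comap (algebraMap A B) ≤ p := fun a ha => hsp a <| by
    have := (algebraMap_dvd_iff_forall_dvd_repr β).1 ((mem_J _).1 ha) i
    rwa [← Algebra.smul_def, map_smul] at this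
  obtain ⟨Q, hJQ, hQ, rfl⟩ := Ideal.exists_ideal_over_prime_of_isIntegral p J hJp
  exact ⟨Q, hQ, hheight, fun b hb => hJQ ((mem_J b).2 hb)⟩

theorem exists_notMem_dvd_mul_of_isIntegral {M : Submonoid B} (hM : M ≤ B⁰) {F : Type*}
    [CommRing F] [Algebra B F] [IsLocalization M F] {Q : Ideal B} [Q.IsPrime]
    (hQ : IsNormalDomain (Localization.AtPrime Q)) {x : F} (hx : IsIntegral B x) {s c : B}
    (hxs : x * algebraMap B F s = algebraMap B F c) : ∃ b ∉ Q, s ∣ b * c := by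
  let R := Localization.AtPrime Q
  obtain ⟨_, _⟩ : IsNormalDomain R := hQ
  let L := FractionRing R
  have hunit (t : M) : IsUnit (Algebra.ofId B L t) := by
    rw [isUnit_iff_ne_zero, Algebra.ofId_apply, IsScalarTower.algebraMap_apply B R L, Ne,
      FaithfulSMul.algebraMap_eq_zero_iff]
    exact nonZeroDivisors.ne_zero
      (IsLocalization.map_nonZeroDivisors_le Q.primeCompl R ⟨t, hM t.2, rfl⟩)
  let ψ : F →ₐ[B] L := IsLocalization.liftAlgHom (M := M) hunit
  have hψx : IsIntegral R (ψ x) := (hx.map ψ).tower_top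
  obtain ⟨d, hd⟩ := IsIntegrallyClosed.isIntegral_iff.1 hψx
  have hds : d * algebraMap B R s = algebraMap B R c := by
    have h := congrArg ψ hxs
    rw [map_mul, ψ.commutes, ψ.commutes, ← hd, IsScalarTower.algebraMap_apply B R L,
      IsScalarTower.algebraMap_apply B R L, ← map_mul] at h
    exact FaithfulSMul.algebraMap_injective R L h
  obtain ⟨b, u, rfl⟩ := IsLocalization.exists_mk'_eq Q.primeCompl d
  have hbs : algebraMap B R (b * s) = algebraMap B R (u * c) := by
    rw [map_mul, map_mul, ← hds, ← mul_assoc, IsLocalization.mk'_spec']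
  obtain ⟨v, hv⟩ := (IsLocalization.eq_iff_exists Q.primeCompl R).1 hbs
  exact ⟨v * u, (v * u).2, v * b, by linear_combination -hv⟩

/-- Let `x = c / s` be integral over `B`. If `s` did not divide `c`, then the ideal
`{b | s ∣ b * c}` would lie in a prime over a prime of height one, at which `B` is normal. -/
theorem isIntegrallyClosedIn_of_forall_height_eq_one [IsDomain A] [IsNoetherianRing A]
    [IsIntegrallyClosed A] [Module.Free A B] [Module.Finite A B] {F : Type*} [CommRing F]
    [Algebra B F] [IsLocalization (Algebra.algebraMapSubmonoid B A⁰) F]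
    (h : ∀ (Q : Ideal B) [Q.IsPrime], (Q.comap (algebraMap A B)).height = 1 →
      IsNormalDomain (Localization.AtPrime Q)) : IsIntegrallyClosedIn B F := by
  have hreg := algebraMapSubmonoid_nonZeroDivisors_le (A := A) (B := B)
  have hinj := IsLocalization.injective F hreg
  refine isIntegrallyClosedIn_iff.2 ⟨hinj, fun {x} hx => ?_⟩
  obtain ⟨⟨c, _, s, hs, rfl⟩, hxs⟩ := IsLocalization.surj (Algebra.algebraMapSubmonoid B A⁰) x
  have hdvd : algebraMap A B s ∣ c := by
    by_contra hsc
    obtain ⟨Q, _, hheight, hQ⟩ :=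
      exists_isPrime_height_comap_eq_one_of_not_dvd (nonZeroDivisors.ne_zero hs) hsc
    obtain ⟨b, hbQ, hb⟩ :=
      exists_notMem_dvd_mul_of_isIntegral hreg (h Q hheight) hx hxs
    exact hbQ (hQ b hb)
  obtain ⟨y, rfl⟩ := hdvd
  have hunit := IsLocalization.map_units F
    (⟨_, s, hs, rfl⟩ : Algebra.algebraMapSubmonoid B A⁰)
  exact ⟨y, hunit.mul_right_cancel (by rw [hxs, map_mul, mul_comm])⟩

end CodimensionOne

section IntegrallyClosedIn

theorem eq_zero_or_eq_one_of_isIntegrallyClosedIn {R F : Type*} [CommRing R] [IsLocalRing R]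
    [CommRing F] [Algebra R F] [IsIntegrallyClosedIn R F] {e : F} (he : IsIdempotentElem e) :
    e = 0 ∨ e = 1 := by
  have hinj : Function.Injective (algebraMap R F) := IsIntegralClosure.algebraMap_injective R R F
  have hint : IsIntegral R e := ⟨X ^ 2 - X, by monicity!, by simp [sq, he.eq]⟩
  obtain ⟨r, rfl⟩ := (IsIntegralClosure.isIntegral_iff (A := R)).1 hint
  have hr : IsIdempotentElem r := hinj (by rw [map_mul]; exact he)
  refine (IsLocalRing.isUnit_or_isUnit_one_sub_self r).symm.imp (fun hu => ?_) fun hu => ?_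
  · rw [sub_eq_self.1 (hu.mul_left_cancel (hr.one_sub.eq.trans (mul_one _).symm)), map_zero]
  · rw [hu.mul_left_cancel (hr.eq.trans (mul_one r).symm), map_one]

theorem isField_of_isIntegrallyClosedIn {R F : Type*} [CommRing R] [IsLocalRing R] [CommRing F]
    [Algebra R F] [IsArtinianRing F] [IsReduced F] [IsIntegrallyClosedIn R F] : IsField F := by
  have : Nontrivial F := (IsIntegralClosure.algebraMap_injective R R F).nontrivial
  have : Subsingleton (MaximalSpectrum F) := by
    classical
    refine ⟨fun m m' => by_contra fun hne => ?_⟩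
    let e := IsArtinianRing.equivPi F
    let x := e.symm (Pi.single m 1)
    have hx : IsIdempotentElem x := by
      rw [IsIdempotentElem, ← map_mul, ← Pi.single_mul, mul_one]
    rcases eq_zero_or_eq_one_of_isIntegrallyClosedIn (R := R) hx with h | h
    · simpa [x] using congrFun (congrArg e h) m
    · simpa [x, hne] using congrFun (congrArg e h) m'
  have := IsLocalRing.of_singleton_maximalSpectrum (R := F)
  exact IsArtinianRing.isField_of_isReduced_of_isLocalRing F

theorem isNormalDomain_of_isIntegrallyClosedIn_of_isField {R F : Type*} [CommRing R] [CommRing F]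
    [Algebra R F] [IsIntegrallyClosedIn R F] (hF : IsField F) : IsNormalDomain R := by
  let := hF.toField
  have hinj : Function.Injective (algebraMap R F) := IsIntegralClosure.algebraMap_injective R R F
  have := hinj.isDomain
  have : FaithfulSMul R F := (faithfulSMul_iff_algebraMap_injective R F).2 hinj
  let φ : FractionRing R →ₐ[R] F := IsFractionRing.liftAlgHom (g := Algebra.ofId R F) hinj
  exact ⟨inferInstance, AlgHom.isIntegrallyClosedIn φ φ.toRingHom.injective inferInstance⟩

theorem isIntegrallyClosedIn_localization {B F : Type*} [CommRing B] [CommRing F] [Algebra B F]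
    [IsIntegrallyClosedIn B F] (M : Submonoid B) :
    IsIntegrallyClosedIn (Localization M) (Localization (Algebra.algebraMapSubmonoid F M)) := by
  let R := Localization M
  let G := Localization (Algebra.algebraMapSubmonoid F M)
  have : IsLocalization (M.map (algebraMap B F)) G := inferInstanceAs (IsLocalization
    (Algebra.algebraMapSubmonoid F M) G)
  refine isIntegrallyClosedIn_iff.2 ⟨IsLocalization.map_injective_of_injective M R G
    (IsIntegralClosure.algebraMap_injective B B F), fun {x} hx => ?_⟩
  obtain ⟨m, hm⟩ := IsIntegral.exists_multiple_integral_of_isLocalization M x hx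
  obtain ⟨⟨y, _, s, hs, rfl⟩, hy⟩ := IsLocalization.surj (Algebra.algebraMapSubmonoid F M) x
  have hmy : algebraMap F G ((m : B) • y) = s • m • x := by
    rw [Algebra.smul_def, map_mul, ← hy, ← IsScalarTower.algebraMap_apply,
      ← IsScalarTower.algebraMap_apply, Submonoid.smul_def, Algebra.smul_def, Algebra.smul_def]
    ring
  obtain ⟨t, ht, hint⟩ := IsLocalization.exists_isIntegral_smul_of_isIntegral_map (Sₘ := G) M
    (x := (m : B) • y) (hmy ▸ hm.smul s)
  obtain ⟨b, hb⟩ := IsIntegrallyClosedIn.algebraMap_eq_of_integral hint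
  let u : M := ⟨t, ht⟩ * ⟨s, hs⟩ * m
  have hbx : algebraMap B G b = algebraMap B G u * x := by
    rw [IsScalarTower.algebraMap_apply B F G, hb, Algebra.smul_def, map_mul, hmy,
      ← IsScalarTower.algebraMap_apply, Submonoid.smul_def, Algebra.smul_def, Algebra.smul_def]
    simp only [u, Submonoid.coe_mul, map_mul, mul_assoc]
    rfl
  refine ⟨IsLocalization.mk' R b u, ((IsLocalization.map_units R u).map
    (algebraMap R G)).mul_left_cancel ?_⟩
  rw [← map_mul, IsLocalization.mk'_spec', ← IsScalarTower.algebraMap_apply, hbx,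
    ← IsScalarTower.algebraMap_apply]

theorem isNormalDomain_localization_of_isIntegrallyClosedIn {B F : Type*} [CommRing B] [CommRing F]
    [Algebra B F] [IsArtinianRing F] [IsReduced F] [IsIntegrallyClosedIn B F] (Q : Ideal B)
    [Q.IsPrime] : IsNormalDomain (Localization.AtPrime Q) := by
  let G := Localization (Algebra.algebraMapSubmonoid F Q.primeCompl)
  have : IsArtinianRing G :=
    IsArtinianRing.localization_artinian (Algebra.algebraMapSubmonoid F Q.primeCompl) G
  have := isIntegrallyClosedIn_localization (F := F) Q.primeCompl
  exact isNormalDomain_of_isIntegrallyClosedIn_of_isField (F := G)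
    (isField_of_isIntegrallyClosedIn (R := Localization.AtPrime Q))

end IntegrallyClosedIn

section Unramified

variable {A B S : Type*} [CommRing A] [CommRing B] [CommRing S] [Algebra A B] [Algebra A S]
  [Algebra B S] [IsScalarTower A B S]

theorem formallyUnramified_of_compAlgebraMap_eq_zero [Algebra.FormallyUnramified B S]
    (h : (D A S).compAlgebraMap B = 0) : Algebra.FormallyUnramified A S := by
  have hmap : KaehlerDifferential.map A A B S = 0 :=
    Derivation.liftKaehlerDifferential_unique _ _ <|
      (KaehlerDifferential.map_compDer A A B S).trans <| h.trans (Derivation.ext fun _ => rfl)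
  refine ⟨subsingleton_of_forall_eq 0 fun ω => ?_⟩
  obtain ⟨ω', rfl⟩ :=
    (KaehlerDifferential.exact_mapBaseChange_map A B S ω).1 (Subsingleton.elim _ _)
  induction ω' with
  | zero => rw [map_zero]
  | tmul s ω => rw [KaehlerDifferential.mapBaseChange_tmul, hmap, LinearMap.zero_apply, smul_zero]
  | add x y hx hy => rw [map_add, hx, hy, add_zero]

theorem formallyUnramified_of_smul_kaehlerDifferential_eq_zero [Algebra.FormallyUnramified B S]
    {Δ : A} (hΔ : ∀ ω : Ω[B⁄A], Δ • ω = 0) (hunit : IsUnit (algebraMap A S Δ)) :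
    Algebra.FormallyUnramified A S := by
  refine formallyUnramified_of_compAlgebraMap_eq_zero (B := B) (Derivation.ext fun b => ?_)
  rw [Derivation.coe_zero, Pi.zero_apply,
    ← Derivation.liftKaehlerDifferential_comp_D ((D A S).compAlgebraMap B),
    ← hunit.smul_eq_zero, algebraMap_smul, ← LinearMap.map_smul_of_tower, hΔ, map_zero]

theorem maximalIdeal_eq_map_sup {R : Type*} [CommRing R] [IsLocalRing A] [IsLocalRing R]
    [Algebra A R] [IsLocalHom (algebraMap A R)] [Algebra.EssFiniteType A R] {I : Ideal R}
    (hI : I ≤ maximalIdeal R) [Algebra.FormallyUnramified A (R ⧸ I)] :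
    maximalIdeal R = (maximalIdeal A).map (algebraMap A R) ⊔ I := by
  have : Nontrivial (R ⧸ I) := Ideal.Quotient.nontrivial_iff.2
    (ne_top_of_le_ne_top (maximalIdeal.isMaximal R).ne_top hI)
  have hsurj : Function.Surjective (Ideal.Quotient.mk I) := Ideal.Quotient.mk_surjective
  have : IsLocalRing (R ⧸ I) := .of_surjective' _ hsurj
  have : IsLocalHom (algebraMap R (R ⧸ I)) := hsurj.isLocalHom
  have : IsLocalHom (algebraMap A (R ⧸ I)) := by
    rw [IsScalarTower.algebraMap_eq A R]
    infer_instance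
  have : Algebra.EssFiniteType A (R ⧸ I) := .comp A R _
  have h := Algebra.FormallyUnramified.map_maximalIdeal (R := A) (S := R ⧸ I)
  rw [IsScalarTower.algebraMap_eq A R, ← Ideal.map_map] at h
  rw [← ((IsLocalRing.local_hom_TFAE (algebraMap R (R ⧸ I))).out 0 4 rfl rfl).1 ‹_›, ← h,
    Ideal.Quotient.algebraMap_eq, Ideal.comap_map_of_surjective' _ hsurj, Ideal.mk_ker]

end Unramified

section LocalizationQuotient

variable {A : Type u} {B : Type v} [CommRing A] [CommRing B] [Algebra A B]

theorem formallyUnramified_localization_quotient_span {q : Ideal B} [q.IsPrime] {t : B}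
    (h : ∀ {M : Type v} [AddCommGroup M] [Module A M] [Module B M] [IsScalarTower A B M]
      (d : Derivation A B M), (∀ b ∉ q, IsSMulRegular M b) → d t = 0 → d = 0) :
    Algebra.FormallyUnramified A
      (Localization.AtPrime q ⧸ Ideal.span {algebraMap B (Localization.AtPrime q) t}) := by
  let S := Localization.AtPrime q ⧸ Ideal.span {algebraMap B (Localization.AtPrime q) t}
  have : Algebra.FormallyUnramified B S := .comp B (Localization.AtPrime q) S
  refine formallyUnramified_of_compAlgebraMap_eq_zero (h _ (fun b hb => ?_) ?_)
  · have hunit : IsUnit (algebraMap B S b) :=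
      (IsLocalization.map_units (Localization.AtPrime q) (⟨b, hb⟩ : q.primeCompl)).map
        (Ideal.Quotient.mk _)
    exact (isSMulRegular_algebraMap_iff S).1 (hunit.isSMulRegular _)
  · have hzero : algebraMap B S t = 0 :=
      Ideal.Quotient.eq_zero_iff_mem.2 (Ideal.mem_span_singleton_self _)
    exact (congrArg (D A S) hzero).trans (map_zero _)

end LocalizationQuotient

theorem isNormalDomain_of_formallyUnramified_quotient_span {R S : Type*} [CommRing R] [CommRing S]
    [IsDomain R] [IsLocalRing R] [IsLocalRing S] [IsNoetherianRing S] [Algebra R S]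
    [IsLocalHom (algebraMap R S)] [Algebra.EssFiniteType R S] [Module.Flat R S] {π : R}
    (hπ : maximalIdeal R = Ideal.span {π}) (hπ_ne : π ≠ 0) {t : S} (ht : t ∈ maximalIdeal S)
    (htπ : t ∣ algebraMap R S π) [Algebra.FormallyUnramified R (S ⧸ Ideal.span {t})] :
    IsNormalDomain S := by
  have hmax : maximalIdeal S = Ideal.span {t} := by
    rw [maximalIdeal_eq_map_sup (A := R) ((Ideal.span_singleton_le_iff_mem _).2 ht), hπ,
      Ideal.map_span, Set.image_singleton, sup_eq_right,
      Ideal.span_singleton_le_span_singleton]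
    exact htπ
  have hπS : algebraMap R S π ∈ S⁰ := algebraMapSubmonoid_nonZeroDivisors_le
    (Algebra.mem_algebraMapSubmonoid_of_mem ⟨π, mem_nonZeroDivisors_of_ne_zero hπ_ne⟩)
  obtain ⟨c, hc⟩ := htπ
  rw [hc] at hπS
  exact isNormalDomain_of_maximalIdeal_eq_span (mul_mem_nonZeroDivisors.1 hπS).1 hmax

theorem isNormalDomain_of_formallyUnramified {R S : Type*} [CommRing R] [CommRing S]
    [IsDomain R] [IsLocalRing R] [IsLocalRing S] [IsNoetherianRing S] [Algebra R S]
    [IsLocalHom (algebraMap R S)] [Algebra.EssFiniteType R S] [Module.Flat R S]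
    [Algebra.FormallyUnramified R S] {π : R} (hπ : maximalIdeal R = Ideal.span {π})
    (hπ_ne : π ≠ 0) : IsNormalDomain S :=
  isNormalDomain_of_formallyUnramified_quotient_span hπ hπ_ne (dvd_refl _)
    (ht := (map_mem_nonunits_iff (algebraMap R S) π).2 (hπ.ge (Ideal.mem_span_singleton_self π)))

section NormalInCodimensionOne

variable {A B : Type*} [CommRing A] [CommRing B] [Algebra A B]

theorem height_comap_comap_algebraMap (M : Submonoid A)
    (Q : Ideal (Localization (Algebra.algebraMapSubmonoid B M))) [Q.IsPrime] :
    ((Q.comap (algebraMap B _)).comap (algebraMap A B)).height =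
      (Q.comap (algebraMap (Localization M) _)).height := by
  rw [← IsLocalization.height_under M (Q.comap (algebraMap (Localization M) _)), Ideal.under_def,
    Ideal.comap_comap, Ideal.comap_comap, ← IsScalarTower.algebraMap_eq,
    ← IsScalarTower.algebraMap_eq]

theorem exists_isPrime_comap_algebraMap_eq (Q : Ideal B) [hQ : Q.IsPrime] :
    ∃ Q₀ : Ideal (Localization (Algebra.algebraMapSubmonoid B
      (Q.comap (algebraMap A B)).primeCompl)), Q₀.IsPrime ∧ Q₀.comap (algebraMap B _) = Q := by
  have hdisj : Disjoint
      (Algebra.algebraMapSubmonoid B (Q.comap (algebraMap A B)).primeCompl : Set B) Q :=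
    Set.disjoint_left.2 (by rintro _ ⟨x, hx, rfl⟩ hxQ; exact hx hxQ)
  exact ⟨_, IsLocalization.isPrime_of_isPrime_disjoint _ _ Q hQ hdisj,
    IsLocalization.under_map_of_isPrime_disjoint _ _ hQ hdisj⟩

variable [Module.Finite A B]

instance isArtinianRing_localization_algebraMapSubmonoid [IsDomain A] :
    IsArtinianRing (Localization (Algebra.algebraMapSubmonoid B A⁰)) :=
  have : Module.Finite (FractionRing A) (Localization (Algebra.algebraMapSubmonoid B A⁰)) :=
    .of_isLocalization A B A⁰
  isArtinian_of_tower (FractionRing A) inferInstance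

theorem isReduced_localization_of_formallyUnramified [IsDomain A]
    [Algebra.FormallyUnramified A (Localization (Algebra.algebraMapSubmonoid B A⁰))] :
    IsReduced (Localization (Algebra.algebraMapSubmonoid B A⁰)) :=
  let F := Localization (Algebra.algebraMapSubmonoid B A⁰)
  have : Module.Finite (FractionRing A) F := .of_isLocalization A B A⁰
  have : Algebra.FormallyUnramified (FractionRing A) F := .of_restrictScalars A _ _
  Algebra.FormallyUnramified.isReduced_of_field (FractionRing A) F

theorem isNormalDomain_localization_of_isReduced [IsDomain A] [IsNoetherianRing A]
    [IsIntegrallyClosed A] [Module.Free A B]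
    [IsReduced (Localization (Algebra.algebraMapSubmonoid B A⁰))]
    (h : ∀ (Q : Ideal B) [Q.IsPrime], (Q.comap (algebraMap A B)).height = 1 →
      IsNormalDomain (Localization.AtPrime Q)) (Q : Ideal B) [Q.IsPrime] :
    IsNormalDomain (Localization.AtPrime Q) :=
  let F := Localization (Algebra.algebraMapSubmonoid B A⁰)
  have : IsIntegrallyClosedIn B F := isIntegrallyClosedIn_of_forall_height_eq_one h
  isNormalDomain_localization_of_isIntegrallyClosedIn (F := F) Q

/-- The argument reduces to the case of a local domain `A` by localizing at `p`, the prime of `A`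
under `Q`. -/
theorem isNormalDomain_localization_of_forall_height_eq_one [IsNoetherianRing A] [Module.Free A B]
    (hA : ∀ (p : Ideal A) [p.IsPrime], IsNormalDomain (Localization.AtPrime p)) {Δ : A}
    (hΔ : Δ ∈ A⁰) (hΩ : ∀ ω : Ω[B⁄A], Δ • ω = 0)
    (h : ∀ (Q : Ideal B) [Q.IsPrime], (Q.comap (algebraMap A B)).height = 1 →
      IsNormalDomain (Localization.AtPrime Q)) (Q : Ideal B) [Q.IsPrime] :
    IsNormalDomain (Localization.AtPrime Q) := by
  let p := Q.comap (algebraMap A B)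
  obtain ⟨_, _⟩ := hA p
  let A₀ := Localization.AtPrime p
  let N := Algebra.algebraMapSubmonoid B p.primeCompl
  let B₀ := Localization N
  have : IsNoetherianRing A₀ := IsLocalization.isNoetherianRing p.primeCompl _ inferInstance
  have : Module.Free A₀ B₀ := Module.free_of_isLocalizedModule p.primeCompl
    (IsScalarTower.toAlgHom A B B₀).toLinearMap
  have : Module.Finite A₀ B₀ := .of_isLocalization A B p.primeCompl
  let F := Localization (Algebra.algebraMapSubmonoid B₀ A₀⁰)
  have hunit : IsUnit (algebraMap A F Δ) := by
    rw [IsScalarTower.algebraMap_apply A A₀ F,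
      IsScalarTower.algebraMap_apply A₀ (FractionRing A₀) F]
    exact (IsLocalization.map_units (FractionRing A₀) (⟨_, IsLocalization.map_nonZeroDivisors_le
      p.primeCompl A₀ ⟨_, hΔ, rfl⟩⟩ : A₀⁰)).map _
  have : Algebra.FormallyUnramified B F := .comp B B₀ F
  have : Algebra.FormallyUnramified A F :=
    formallyUnramified_of_smul_kaehlerDifferential_eq_zero hΩ hunit
  have : Algebra.FormallyUnramified A₀ F := .of_restrictScalars A A₀ F
  have : IsReduced F := isReduced_localization_of_formallyUnramified
  have hB₀ (Q₀ : Ideal B₀) [Q₀.IsPrime] (hQ₀ : (Q₀.comap (algebraMap A₀ B₀)).height = 1) :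
      IsNormalDomain (Localization.AtPrime Q₀) :=
    (isNormalDomain_localization_iff_of_comap_eq rfl).1
      (h _ ((height_comap_comap_algebraMap _ Q₀).trans hQ₀))
  obtain ⟨Q₀, _, hQ₀⟩ := exists_isPrime_comap_algebraMap_eq (A := A) Q
  exact (isNormalDomain_localization_iff_of_comap_eq hQ₀).2
    (isNormalDomain_localization_of_isReduced hB₀ Q₀)

end NormalInCodimensionOne

section Differentials

variable {A : Type*} [CommRing A] {n : ℕ} {a : ℕ → A}

theorem adjoin_range_eta : Algebra.adjoin A (Set.range (eta n a)) = ⊤ := by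
  have hrange : Set.range (eta n a) = mkHom n a '' Set.range MvPolynomial.X :=
    Set.range_comp (mkHom n a) MvPolynomial.X
  rw [hrange, ← AlgHom.map_adjoin, MvPolynomial.adjoin_range_X, Algebra.map_top,
    AlgHom.range_eq_top]
  exact Ideal.Quotient.mkₐ_surjective A _

theorem aeval_evenPoly_eta (i : Fin n) : aeval (eta n a i) (evenPoly n a) = 0 := by
  rw [← eval_map_algebraMap, map_evenPoly, eval_prod]
  exact Finset.prod_eq_zero (Finset.mem_univ i) (by simp)

section Derivation

variable {M : Type*} [AddCommGroup M] [Module A M] [Module (SSplit n a) M]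
  (d : Derivation A (SSplit n a) M)

variable {d} in
theorem derivation_eq_zero (h : ∀ i, d (eta n a i) = 0) : d = 0 :=
  Derivation.ext_of_adjoin_eq_top _ adjoin_range_eta (by rintro _ ⟨i, rfl⟩; exact h i)

theorem aeval_derivative_evenPoly (i : Fin n) :
    aeval (eta n a i) (derivative (evenPoly n a)) =
      2 * eta n a i * ∏ j ∈ {i}ᶜ, (eta n a i ^ 2 - eta n a j ^ 2) := by
  rw [aeval_def, ← eval_map, ← derivative_map, map_evenPoly, derivative_prod_finset,
    eval_finsetSum, Finset.sum_eq_single i, Finset.compl_eq_univ_sdiff,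
    Finset.sdiff_singleton_eq_erase]
  · rw [eval_mul, mul_comm]
    simp [eval_prod, -map_pow, one_add_one_eq_two]
  · intro j _ hji
    rw [eval_mul, eval_prod, Finset.prod_eq_zero (i := i) (by simp [hji.symm]) (by simp), zero_mul]
  · simp

theorem prod_smul_derivation_eta (i : Fin n) :
    (2 * eta n a i * ∏ j ∈ {i}ᶜ, (eta n a i ^ 2 - eta n a j ^ 2)) • d (eta n a i) = 0 := by
  rw [← aeval_derivative_evenPoly, ← Derivation.map_aeval, aeval_evenPoly_eta, map_zero]

theorem sum_smul_derivation_eta : ∑ i, (2 * eta n a i) • d (eta n a i) = 0 := by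
  rcases n.eq_zero_or_pos with rfl | hn
  · exact Fintype.sum_empty _
  have hcoeff := prod_X_sub_C_coeff_card_pred (Finset.univ : Finset (Fin n))
    (fun i => eta n a i ^ 2) (by simpa using hn)
  rw [← map_halfPoly, coeff_map] at hcoeff
  have hsum : d (∑ i, eta n a i ^ 2) = 0 := by
    rw [← neg_eq_zero, ← map_neg, ← hcoeff, Derivation.map_algebraMap]
  simpa [Derivation.leibniz_pow, mul_smul, ofNat_smul_eq_nsmul] using hsum

end Derivation

theorem prod_compl_singleton_sub_dvd {R : Type*} [CommRing R] (x : Fin n → R) (i : Fin n) :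
    ∏ j ∈ {i}ᶜ, (x i - x j) ∣ ∏ i, ∏ j ∈ Finset.Ioi i, (x i - x j) ^ 2 := by
  have hsq (k j : Fin n) : (x k - x j) ^ 2 = -1 * ((x k - x j) * (x j - x k)) := by ring
  simp_rw [hsq, Finset.prod_mul_distrib (f := fun _ => (-1 : R))]
  rw [Finset.prod_mul_distrib,
    Finset.prod_prod_Ioi_mul_eq_prod_prod_off_diag (fun j k => x k - x j)]
  exact dvd_mul_of_dvd_right
    (Finset.dvd_prod_of_mem (fun k => ∏ j ∈ {k}ᶜ, (x k - x j)) (Finset.mem_univ i)) _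

theorem prod_dvd_Delta (ha : a 0 = 1) (i : Fin n) :
    2 * eta n a i * ∏ j ∈ {i}ᶜ, (eta n a i ^ 2 - eta n a j ^ 2) ∣
      algebraMap A (SSplit n a) (Delta n a) := by
  have htwo : (2 : SSplit n a) ∣ 4 ^ n :=
    (Dvd.intro 2 (by norm_num)).trans (dvd_pow_self _ i.pos.ne')
  have heta : eta n a i ∣ ∏ j, eta n a j ^ 2 :=
    (dvd_pow_self _ two_ne_zero).trans
      (Finset.dvd_prod_of_mem (fun j => eta n a j ^ 2) (Finset.mem_univ i))
  rw [algebraMap_Delta n a ha]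
  exact mul_dvd_mul (mul_dvd_mul htwo heta)
    (prod_compl_singleton_sub_dvd (fun j => eta n a j ^ 2) i)

theorem Delta_smul_kaehlerDifferential_eq_zero (ha : a 0 = 1) (ω : Ω[SSplit n a⁄A]) :
    Delta n a • ω = 0 := by
  have hD : Delta n a • D A (SSplit n a) = 0 := derivation_eq_zero fun i => by
    obtain ⟨c, hc⟩ := prod_dvd_Delta ha i
    rw [Derivation.smul_apply, ← algebraMap_smul (SSplit n a), hc, mul_comm, mul_smul,
      prod_smul_derivation_eta, smul_zero]
  have hid : (Delta n a • LinearMap.id : Ω[SSplit n a⁄A] →ₗ[SSplit n a] Ω[SSplit n a⁄A]) = 0 :=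
    Derivation.liftKaehlerDifferential_unique _ _ (by
      ext b; simpa using DFunLike.congr_fun hD b)
  exact DFunLike.congr_fun hid ω

theorem coincidence_dvd_Delta (ha : a 0 = 1) (s) :
    coincidence n a s ∣ algebraMap A (SSplit n a) (Delta n a) := by
  rw [algebraMap_Delta n a ha]
  rcases s with i | ⟨⟨i, j⟩, hij⟩
  · exact ((dvd_pow_self _ two_ne_zero).trans (Finset.dvd_prod_of_mem
      (fun i => eta n a i ^ 2) (Finset.mem_univ i))).trans
        (dvd_mul_of_dvd_left (dvd_mul_left _ _) _)
  · exact ((dvd_pow_self _ two_ne_zero).trans (Finset.dvd_prod_of_mem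
      (fun j => (eta n a i ^ 2 - eta n a j ^ 2) ^ 2) (Finset.mem_Ioi.2 hij))).trans
        (dvd_mul_of_dvd_right (Finset.dvd_prod_of_mem _ (Finset.mem_univ i)) _)

section AtPrime

variable {q : Ideal (SSplit n a)} [hq : q.IsPrime]

theorem exists_coincidence_mem (ha : a 0 = 1) (h2 : 2 ∉ q)
    (hΔ : algebraMap A (SSplit n a) (Delta n a) ∈ q) : ∃ s, coincidence n a s ∈ q := by
  rw [algebraMap_Delta n a ha, hq.mul_mem_iff_mem_or_mem, hq.mul_mem_iff_mem_or_mem] at hΔ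
  rcases hΔ with (h4 | heta) | hsub
  · have h4 : (2 ^ 2 : SSplit n a) ∈ q := by convert hq.mem_of_pow_mem _ h4 using 1; norm_num
    exact absurd (hq.mem_of_pow_mem _ h4) h2
  · obtain ⟨i, -, hi⟩ := hq.prod_mem_iff.1 heta
    exact ⟨.inl i, hq.mem_of_pow_mem _ hi⟩
  · obtain ⟨i, -, hi⟩ := hq.prod_mem_iff.1 hsub
    obtain ⟨j, hj, hij⟩ := hq.prod_mem_iff.1 hi
    exact ⟨.inr ⟨(i, j), Finset.mem_Ioi.1 hj⟩, hq.mem_of_pow_mem _ hij⟩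

variable {M : Type*} [AddCommGroup M] [Module A M] [Module (SSplit n a) M]
  {d : Derivation A (SSplit n a) M}

theorem derivation_eta_eq_zero (hM : ∀ b ∉ q, IsSMulRegular M b) (h2 : 2 ∉ q) {i : Fin n}
    (hi : eta n a i ∉ q) (hij : ∀ j ≠ i, eta n a i ^ 2 - eta n a j ^ 2 ∉ q) :
    d (eta n a i) = 0 := by
  have hmem : 2 * eta n a i * ∏ j ∈ {i}ᶜ, (eta n a i ^ 2 - eta n a j ^ 2) ∉ q := by
    simpa [hq.mul_mem_iff_mem_or_mem, hq.prod_mem_iff, h2, hi] using hij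
  exact hM _ hmem ((prod_smul_derivation_eta d i).trans (smul_zero _).symm)

theorem derivation_eta_eq_zero_of_map_sub_eq_zero [IsScalarTower A (SSplit n a) M]
    (hM : ∀ b ∉ q, IsSMulRegular M b) (h2 : 2 ∉ q) {i j : Fin n} (hij : i ≠ j)
    (hi : eta n a i ∉ q) {ε : A} (hε : ε ^ 2 = 1) (hmem : eta n a j - ε • eta n a i ∈ q)
    (hd : d (eta n a j - ε • eta n a i) = 0)
    (h : ∀ k, k ≠ i → k ≠ j → d (eta n a k) = 0) : d (eta n a i) = 0 := by
  have hj : d (eta n a j) = ε • d (eta n a i) := by rwa [map_sub, d.map_smul, sub_eq_zero] at hd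
  have hsum := sum_smul_derivation_eta d
  rw [Finset.sum_eq_add i j hij (fun k _ hk => by rw [h k hk.1 hk.2, smul_zero]) (by simp)
    (by simp), hj, ← algebraMap_smul (SSplit n a) ε, smul_smul, ← add_smul] at hsum
  have hnotMem : 2 * eta n a i + 2 * eta n a j * algebraMap A (SSplit n a) ε ∉ q := fun hq' => by
    have hε' : algebraMap A (SSplit n a) ε ^ 2 = 1 := by rw [← map_pow, hε, map_one]
    have heq : 2 * (2 * eta n a i) =
        2 * eta n a i + 2 * eta n a j * algebraMap A (SSplit n a) ε -
          2 * algebraMap A (SSplit n a) ε * (eta n a j - ε • eta n a i) := by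
      rw [Algebra.smul_def]
      linear_combination (-2 * eta n a i) * hε'
    have := heq ▸ q.sub_mem hq' (q.mul_mem_left _ hmem)
    simp [hq.mul_mem_iff_mem_or_mem, h2, hi] at this
  exact hM _ hnotMem (hsum.trans (smul_zero _).symm)

theorem derivation_eta_eq_zero_of_forall_coincidence_notMem (hM : ∀ b ∉ q, IsSMulRegular M b)
    (h2 : 2 ∉ q) {i : Fin n} (hi : coincidence n a (.inl i) ∉ q)
    (hij : ∀ p, p.1.1 = i ∨ p.1.2 = i → coincidence n a (.inr p) ∉ q) :
    d (eta n a i) = 0 := by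
  refine derivation_eta_eq_zero hM h2 hi fun j hji => ?_
  rcases lt_or_gt_of_ne hji with h | h
  · rw [← neg_sub, Ideal.neg_mem_iff]
    exact hij ⟨(j, i), h⟩ (.inr rfl)
  · exact hij ⟨(i, j), h⟩ (.inl rfl)

theorem derivation_eq_zero_of_forall_ne_inl (hM : ∀ b ∉ q, IsSMulRegular M b) (h2 : 2 ∉ q)
    {i : Fin n} (h : ∀ s ≠ .inl i, coincidence n a s ∉ q) (hd : d (eta n a i) = 0) : d = 0 :=
  derivation_eq_zero fun k => by
    rcases eq_or_ne k i with rfl | hki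
    · exact hd
    · exact derivation_eta_eq_zero_of_forall_coincidence_notMem hM h2 (h _ (by simpa using hki))
        fun p _ => h _ (by simp)

theorem derivation_eq_zero_of_forall_ne_inr [IsScalarTower A (SSplit n a) M]
    (hM : ∀ b ∉ q, IsSMulRegular M b) (h2 : 2 ∉ q) {i j : Fin n} (hij : i < j)
    (h : ∀ s ≠ .inr ⟨(i, j), hij⟩, coincidence n a s ∉ q) {ε : A} (hε : ε ^ 2 = 1)
    (hmem : eta n a j - ε • eta n a i ∈ q) (hd : d (eta n a j - ε • eta n a i) = 0) : d = 0 := by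
  have hk (k : Fin n) (hki : k ≠ i) (hkj : k ≠ j) : d (eta n a k) = 0 := by
    refine derivation_eta_eq_zero_of_forall_coincidence_notMem hM h2 (h _ (by simp)) ?_
    rintro p (rfl | rfl) <;> refine h _ fun hp => ?_ <;> cases hp
    · exact hki rfl
    · exact hkj rfl
  have hi : d (eta n a i) = 0 :=
    derivation_eta_eq_zero_of_map_sub_eq_zero hM h2 hij.ne (h (.inl i) (by simp)) hε hmem hd hk
  have hj : d (eta n a j) = 0 := by rwa [map_sub, d.map_smul, hi, smul_zero, sub_zero] at hd
  refine derivation_eq_zero fun k => ?_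
  rcases eq_or_ne k i with rfl | hki
  · exact hi
  rcases eq_or_ne k j with rfl | hkj
  · exact hj
  exact hk k hki hkj

theorem exists_sub_smul_mem {i j : Fin n} (h : eta n a i ^ 2 - eta n a j ^ 2 ∈ q) :
    ∃ ε : A, ε ^ 2 = 1 ∧ eta n a j - ε • eta n a i ∈ q ∧
      eta n a j - ε • eta n a i ∣ eta n a i ^ 2 - eta n a j ^ 2 := by
  have hdvd (ε : A) (hε : ε ^ 2 = 1) :
      eta n a j - ε • eta n a i ∣ eta n a i ^ 2 - eta n a j ^ 2 := by
    refine ⟨-(eta n a j + ε • eta n a i), ?_⟩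
    rw [← one_smul A (eta n a i ^ 2), ← hε, ← _root_.smul_pow]
    ring
  rw [sq_sub_sq, hq.mul_mem_iff_mem_or_mem] at h
  rcases h with h | h
  · exact ⟨-1, by ring, by simpa [add_comm] using h, hdvd _ (by ring)⟩
  · exact ⟨1, by ring, by simpa using q.neg_mem h, hdvd _ (by ring)⟩

/-- The element `t` is `ηᵢ` or `ηⱼ ± ηᵢ`, according to the coincidence that occurs at `q`. -/
theorem exists_dvd_Delta_formallyUnramified_quotient (ha : a 0 = 1) (h2 : 2 ∉ q)
    (hE : ∀ s t, s ≠ t → coincidence n a s ∈ q → coincidence n a t ∉ q)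
    (hΔ : algebraMap A (SSplit n a) (Delta n a) ∈ q) :
    ∃ t ∈ q, t ∣ algebraMap A (SSplit n a) (Delta n a) ∧ Algebra.FormallyUnramified A
      (Localization.AtPrime q ⧸ Ideal.span {algebraMap _ (Localization.AtPrime q) t}) := by
  obtain ⟨s, hs⟩ := exists_coincidence_mem ha h2 hΔ
  have hne (t) (hts : t ≠ s) : coincidence n a t ∉ q := hE s t hts.symm hs
  rcases s with i | ⟨⟨i, j⟩, hij⟩
  · exact ⟨eta n a i, hs, coincidence_dvd_Delta ha (.inl i),
      formallyUnramified_localization_quotient_span fun _ hM hd =>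
        derivation_eq_zero_of_forall_ne_inl hM h2 hne hd⟩
  · obtain ⟨ε, hε, hmem, hdvd⟩ := exists_sub_smul_mem hs
    exact ⟨_, hmem, hdvd.trans (coincidence_dvd_Delta ha (.inr ⟨(i, j), hij⟩)),
      formallyUnramified_localization_quotient_span fun _ hM hd =>
        derivation_eq_zero_of_forall_ne_inr hM h2 hij hne hε hmem hd⟩

end AtPrime

end Differentials

section HeightOne

variable {A : Type*} [CommRing A] {n : ℕ} {a : ℕ → A} {p : Ideal A} [hp : p.IsPrime]

theorem Delta_mem_sq_of_two_mem (ha : a 0 = 1) {I : Ideal A} (hΔ : Delta n a ∈ I) (h2 : 2 ∈ I) :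
    Delta n a ∈ I ^ 2 := by
  rcases n with - | n
  · have hone : Delta 0 a = 1 := by
      have hC : halfPoly 0 a = C 1 := by simp [halfPoly, ha]
      rw [Delta, hC, discr_C, pow_zero, mul_zero, ha, one_mul, one_mul]
    rw [hone, ← one_pow 2]
    exact Ideal.pow_mem_pow (hone ▸ hΔ) 2
  · have hfactor : Delta (n + 1) a =
        2 ^ 2 * (-(-4) ^ n * a (2 * (n + 1)) * (halfPoly (n + 1) a).discr) := by
      rw [Delta]; ring
    rw [hfactor]
    exact Ideal.mul_mem_right _ _ (Ideal.pow_mem_pow h2 2)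

theorem two_notMem_of_algebraMap_Delta_notMem_sq (ha : a 0 = 1) (hΔ : Delta n a ∈ p)
    (hΔ2 : algebraMap A (Localization.AtPrime p) (Delta n a) ∉
      maximalIdeal (Localization.AtPrime p) ^ 2) : 2 ∉ p := fun h2 => hΔ2 <| by
  rw [← Localization.AtPrime.map_eq_maximalIdeal, ← Ideal.map_pow]
  exact Ideal.mem_map_of_mem _ (Delta_mem_sq_of_two_mem ha hΔ h2)

theorem isNormalDomain_localization_of_height_eq_one [IsNoetherianRing A]
    [Module.Free A (SSplit n a)] [Module.Finite A (SSplit n a)] (ha : a 0 = 1)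
    (hheight : p.height = 1) (hA : IsNormalDomain (Localization.AtPrime p))
    (hΔ : algebraMap A (Localization.AtPrime p) (Delta n a) ∉
      maximalIdeal (Localization.AtPrime p) ^ 2) (q : Ideal (SSplit n a)) [q.IsPrime]
    [hqp : q.LiesOver p]
    (hE : ∀ s t, s ≠ t → coincidence n a s ∈ q → coincidence n a t ∉ q) :
    IsNormalDomain (Localization.AtPrime q) := by
  obtain ⟨_, _⟩ := hA
  let R := Localization.AtPrime p
  let S := Localization.AtPrime q
  let : Algebra R S := Localization.AtPrime.algebraOfLiesOver p q
  have : IsNoetherianRing (SSplit n a) := isNoetherian_of_tower A inferInstance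
  have : IsNoetherianRing R := IsLocalization.isNoetherianRing p.primeCompl _ inferInstance
  have : IsNoetherianRing S := IsLocalization.isNoetherianRing q.primeCompl _ inferInstance
  have : Algebra.EssFiniteType A S := .comp A (SSplit n a) S
  have : Algebra.EssFiniteType R S := .of_comp A R S
  have hR : (maximalIdeal R).height = 1 := by
    rw [← hheight, ← IsLocalization.height_under p.primeCompl,
      IsLocalization.AtPrime.under_maximalIdeal R p]
  obtain ⟨π, hπ⟩ := exists_maximalIdeal_eq_span_of_height_eq_one hR
  by_cases hΔp : Delta n a ∈ p
  · have h2 : (2 : SSplit n a) ∉ q := by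
      rw [← map_ofNat (algebraMap A (SSplit n a)) 2, ← Ideal.mem_comap, ← Ideal.under_def,
        ← hqp.over]
      exact two_notMem_of_algebraMap_Delta_notMem_sq ha hΔp hΔ
    have hΔq : algebraMap A (SSplit n a) (Delta n a) ∈ q := by
      rwa [hqp.over, Ideal.mem_comap] at hΔp
    obtain ⟨t, htq, htΔ, _⟩ := exists_dvd_Delta_formallyUnramified_quotient ha h2 hE hΔq
    have hΔR : maximalIdeal R = Ideal.span {algebraMap A R (Delta n a)} :=
      maximalIdeal_eq_span_of_notMem_sq hπ
        ((IsLocalization.AtPrime.to_map_mem_maximal_iff R p _).2 hΔp) hΔ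
    have := Algebra.FormallyUnramified.of_restrictScalars A R
      (S ⧸ Ideal.span {algebraMap (SSplit n a) S t})
    refine isNormalDomain_of_formallyUnramified_quotient_span hΔR
      (ne_zero_of_maximalIdeal_eq_span hΔR hR)
      ((IsLocalization.AtPrime.to_map_mem_maximal_iff S q t).2 htq) ?_
    rw [← IsScalarTower.algebraMap_apply A R S, IsScalarTower.algebraMap_apply A (SSplit n a) S]
    exact map_dvd _ htΔ
  · have hunit : IsUnit (algebraMap A S (Delta n a)) := by
      rw [IsScalarTower.algebraMap_apply A R S]
      exact (IsLocalization.map_units R (⟨_, hΔp⟩ : p.primeCompl)).map _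
    have : Algebra.FormallyUnramified A S := formallyUnramified_of_smul_kaehlerDifferential_eq_zero
      (Delta_smul_kaehlerDifferential_eq_zero ha) hunit
    have : Algebra.FormallyUnramified R S := .of_restrictScalars A R S
    exact isNormalDomain_of_formallyUnramified hπ (ne_zero_of_maximalIdeal_eq_span hπ hR)

end HeightOne

/-! ### The signed splitting ring is finite free -/

namespace SSplit

variable {A : Type u} [CommRing A] {n : ℕ} {a : ℕ → A} {S : Type*} [CommRing S] [Algebra A S]

theorem relIdeal_le_ker_aeval {θ : Fin n → S}
    (hθ : (evenPoly n a).map (algebraMap A S) = ∏ i, (X ^ 2 - C (θ i ^ 2))) :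
    relIdeal n a ≤ RingHom.ker (MvPolynomial.aeval θ : MvPolynomial (Fin n) A →ₐ[A] S) := by
  refine Ideal.span_le.2 ?_
  rintro _ ⟨k, rfl⟩
  have hC : (MvPolynomial.aeval θ : MvPolynomial (Fin n) A →ₐ[A] S).toRingHom.comp
      MvPolynomial.C = algebraMap A S := (MvPolynomial.aeval θ).comp_algebraMap
  have hmap : ((evenPoly n a).map (MvPolynomial.C : A →+* MvPolynomial (Fin n) A) -
      ∏ i : Fin n, (X ^ 2 - C (MvPolynomial.X i ^ 2))).map
        (MvPolynomial.aeval θ : MvPolynomial (Fin n) A →ₐ[A] S).toRingHom = 0 := by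
    rw [Polynomial.map_sub, Polynomial.map_map, hC, hθ, Polynomial.map_prod, sub_eq_zero]
    simp
  exact (coeff_map _ k).symm.trans (by rw [hmap, coeff_zero])

/-- The homomorphism out of the signed splitting ring given by a factorization of `f` over `S`. -/
noncomputable def lift (θ : Fin n → S)
    (hθ : (evenPoly n a).map (algebraMap A S) = ∏ i, (X ^ 2 - C (θ i ^ 2))) :
    SSplit n a →ₐ[A] S :=
  Ideal.Quotient.liftₐ (relIdeal n a) (MvPolynomial.aeval θ) fun _ hx =>
    relIdeal_le_ker_aeval hθ hx

theorem lift_eta (θ : Fin n → S)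
    (hθ : (evenPoly n a).map (algebraMap A S) = ∏ i, (X ^ 2 - C (θ i ^ 2))) (i : Fin n) :
    lift θ hθ (eta n a i) = θ i :=
  MvPolynomial.aeval_X θ i

theorem algHom_ext {φ ψ : SSplit n a →ₐ[A] S} (h : ∀ i, φ (eta n a i) = ψ (eta n a i)) : φ = ψ :=
  AlgHom.ext_of_adjoin_eq_top adjoin_range_eta (by rintro _ ⟨i, rfl⟩; exact h i)

/-- The signed splitting ring of a constant polynomial is the base ring. -/
noncomputable def zeroEquiv (ha : a 0 = 1) : SSplit 0 a ≃ₐ[A] A :=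
  AlgEquiv.ofAlgHom (lift Fin.elim0 (by simp [evenPoly, ha])) (Algebra.ofId A _)
    (Subsingleton.elim _ _) (algHom_ext fun i => i.elim0)

end SSplit

section AdjoinRoot

variable {A : Type u} [CommRing A] {n : ℕ} {a : ℕ → A}

theorem evenPoly_monic (ha : a 0 = 1) : (evenPoly n a).Monic :=
  expand_halfPoly n a ▸ (halfPoly_monic n a ha).expand two_pos

theorem natDegree_halfPoly [Nontrivial A] (ha : a 0 = 1) : (halfPoly n a).natDegree = n := by
  refine natDegree_eq_of_le_of_coeff_ne_zero (natDegree_sum_le_of_forall_le _ _ fun i hi => ?_) ?_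
  · exact (natDegree_C_mul_X_pow_le _ _).trans (by simpa [Nat.lt_succ_iff] using hi)
  · simp [halfPoly, coeff_X_pow, ha]

theorem exists_halfPoly_eq {g : A[X]} (hg : g.Monic) (hn : g.natDegree = n) :
    ∃ a : ℕ → A, a 0 = 1 ∧ halfPoly n a = g := by
  refine ⟨fun k => g.coeff (n - k / 2), by simpa [hn] using hg.coeff_natDegree, ?_⟩
  conv_rhs => rw [g.as_sum_range_C_mul_X_pow' (n := n + 1) (by omega)]
  refine Finset.sum_congr rfl fun i hi => ?_
  have hi : i < n + 1 := Finset.mem_range.1 hi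
  simp only [show n - (2 * n - 2 * i) / 2 = i by omega]

theorem exists_map_evenPoly_eq_mul {S : Type*} [CommRing S] [Algebra A S] (ha : a 0 = 1) {r : S}
    (hr : aeval r (evenPoly (n + 1) a) = 0) : ∃ b : ℕ → S, b 0 = 1 ∧
      (evenPoly (n + 1) a).map (algebraMap A S) = (X ^ 2 - C (r ^ 2)) * evenPoly n b := by
  rcases subsingleton_or_nontrivial S with _ | _
  · exact ⟨1, rfl, Subsingleton.elim _ _⟩
  have : Nontrivial A := (algebraMap A S).domain_nontrivial
  have hmonic := (halfPoly_monic (n + 1) a ha).map (algebraMap A S)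
  have hroot : ((halfPoly (n + 1) a).map (algebraMap A S)).IsRoot (r ^ 2) := by
    rwa [IsRoot, eval_map_algebraMap, ← expand_aeval, expand_halfPoly]
  have hmul := mul_divByMonic_eq_iff_isRoot.2 hroot
  have hquot : ((halfPoly (n + 1) a).map (algebraMap A S) /ₘ (X - C (r ^ 2))).Monic :=
    (monic_X_sub_C _).of_mul_monic_left (hmul.symm ▸ hmonic)
  obtain ⟨b, hb, hbquot⟩ := exists_halfPoly_eq (n := n) hquot (by
    rw [natDegree_divByMonic _ (monic_X_sub_C _), (halfPoly_monic _ a ha).natDegree_map,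
      natDegree_halfPoly ha, natDegree_X_sub_C, Nat.add_sub_cancel])
  refine ⟨b, hb, ?_⟩
  rw [← expand_halfPoly, map_expand, ← hmul, ← hbquot, map_mul, expand_halfPoly, map_sub,
    expand_X, expand_C]

theorem map_evenPoly_eq_prod_succ {R : Type u} [CommRing R] [Algebra A R] {b : ℕ → R}
    (ψ : R →ₐ[A] SSplit (n + 1) a) {r : R} (hr : ψ r = eta (n + 1) a 0)
    (hb : (evenPoly (n + 1) a).map (algebraMap A R) = (X ^ 2 - C (r ^ 2)) * evenPoly n b) :
    (evenPoly n b).map (ψ : R →+* SSplit (n + 1) a) =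
      ∏ i : Fin n, (X ^ 2 - C (eta (n + 1) a i.succ ^ 2)) := by
  have hmonic : (X ^ 2 - C (eta (n + 1) a 0 ^ 2)).Monic := monic_X_pow_sub_C _ two_ne_zero
  refine hmonic.isRegular.left ?_
  have hmap := congrArg (Polynomial.map (ψ : R →+* SSplit (n + 1) a)) hb
  rw [Polynomial.map_map, AlgHom.comp_algebraMap, map_evenPoly, Fin.prod_univ_succ] at hmap
  simpa [hr] using hmap.symm

theorem map_evenPoly_eq_prod_cons {R : Type u} [CommRing R] [Algebra A R] {b : ℕ → R} {r : R}
    (hb : (evenPoly (n + 1) a).map (algebraMap A R) = (X ^ 2 - C (r ^ 2)) * evenPoly n b)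
    [Algebra A (SSplit n b)] [IsScalarTower A R (SSplit n b)] :
    (evenPoly (n + 1) a).map (algebraMap A (SSplit n b)) =
      ∏ i, (X ^ 2 -
        C (Fin.cons (α := fun _ => SSplit n b) (algebraMap R _ r) (eta n b) i ^ 2)) := by
  rw [IsScalarTower.algebraMap_eq A R, ← Polynomial.map_map, hb, Polynomial.map_mul, map_evenPoly,
    Fin.prod_univ_succ]
  simp

theorem nonempty_algEquiv_adjoinRoot {b : ℕ → AdjoinRoot (evenPoly (n + 1) a)}
    (hb : (evenPoly (n + 1) a).map (algebraMap A _) =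
      (X ^ 2 - C (AdjoinRoot.root (evenPoly (n + 1) a) ^ 2)) * evenPoly n b)
    [Algebra A (SSplit n b)] [IsScalarTower A (AdjoinRoot (evenPoly (n + 1) a)) (SSplit n b)] :
    Nonempty (SSplit n b ≃ₐ[A] SSplit (n + 1) a) := by
  let A' := AdjoinRoot (evenPoly (n + 1) a)
  let F : SSplit (n + 1) a →ₐ[A] SSplit n b := SSplit.lift _ (map_evenPoly_eq_prod_cons hb)
  let ψ : A' →ₐ[A] SSplit (n + 1) a :=
    AdjoinRoot.liftAlgHom _ (Algebra.ofId A _) (eta (n + 1) a 0) (aeval_evenPoly_eta 0)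
  have hψ : ψ (AdjoinRoot.root _) = eta (n + 1) a 0 := AdjoinRoot.liftAlgHom_root _ _ _ _
  let : Algebra A' (SSplit (n + 1) a) := ψ.toAlgebra
  have : IsScalarTower A A' (SSplit (n + 1) a) := .of_algebraMap_eq' ψ.comp_algebraMap.symm
  let G : SSplit n b →ₐ[A'] SSplit (n + 1) a :=
    SSplit.lift _ (map_evenPoly_eq_prod_succ ψ hψ hb)
  have hGη (i : Fin n) : G (eta n b i) = eta (n + 1) a i.succ := SSplit.lift_eta _ _ i
  have hFη (i : Fin n) : F (eta (n + 1) a i.succ) = eta n b i := SSplit.lift_eta _ _ _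
  have hF0 : F (eta (n + 1) a 0) = algebraMap A' _ (AdjoinRoot.root _) := SSplit.lift_eta _ _ 0
  have hFψ : F.comp ψ = Algebra.algHom A A' (SSplit n b) :=
    AdjoinRoot.algHom_ext ((congrArg F hψ).trans hF0)
  let F' : SSplit (n + 1) a →ₐ[A'] SSplit n b :=
    { F with commutes' := DFunLike.congr_fun hFψ }
  have hFG : F'.comp G = AlgHom.id A' _ :=
    SSplit.algHom_ext fun i => (congrArg F (hGη i)).trans (hFη i)
  have hGF : (G.restrictScalars A).comp F = AlgHom.id A _ :=
    SSplit.algHom_ext (Fin.cases ((congrArg G hF0).trans ((G.commutes _).trans hψ))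
      fun i => (congrArg G (hFη i)).trans (hGη i))
  exact ⟨.ofAlgHom (G.restrictScalars A) F hGF (AlgHom.ext (DFunLike.congr_fun hFG :))⟩

end AdjoinRoot

theorem free_and_finite (n : ℕ) : ∀ {A : Type*} [CommRing A] {a : ℕ → A}, a 0 = 1 →
    Module.Free A (SSplit n a) ∧ Module.Finite A (SSplit n a) := by
  induction n with
  | zero =>
    intro A _ a ha
    exact ⟨.of_equiv (SSplit.zeroEquiv ha).symm.toLinearEquiv,
      .equiv (SSplit.zeroEquiv ha).symm.toLinearEquiv⟩
  | succ n ih =>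
    intro A _ a ha
    obtain ⟨b, hb, hfactor⟩ := exists_map_evenPoly_eq_mul ha
      (AdjoinRoot.aeval_algHom_eq_zero _ (AlgHom.id A (AdjoinRoot (evenPoly (n + 1) a))))
    obtain ⟨_, _⟩ := ih hb
    let A' := AdjoinRoot (evenPoly (n + 1) a)
    have : Module.Free A A' := (evenPoly_monic ha).free_adjoinRoot
    have : Module.Finite A A' := (evenPoly_monic ha).finite_adjoinRoot
    let : Algebra A (SSplit n b) := Algebra.compHom _ (algebraMap A A')
    have : IsScalarTower A A' (SSplit n b) := .of_algebraMap_eq fun _ => rfl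
    have : Module.Free A (SSplit n b) := .trans (S := A')
    have : Module.Finite A (SSplit n b) := .trans A' _
    obtain ⟨e⟩ := nonempty_algEquiv_adjoinRoot hfactor
    exact ⟨.of_equiv e.toLinearEquiv, .equiv e.toLinearEquiv⟩

/-! ### Coincidences and second-order vanishing -/

theorem det_mem_maximalIdeal_sq {R ι : Type*} [CommRing R] [IsLocalRing R] [Fintype ι]
    [DecidableEq ι] [Nonempty ι] (T : Matrix ι ι R)
    (hT : ∀ i j, T.adjugate i j ∈ maximalIdeal R) : T.det ∈ maximalIdeal R ^ 2 := by
  have hdet : T.det ∈ maximalIdeal R := by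
    obtain ⟨i⟩ := ‹Nonempty ι›
    have hii : (T.adjugate * T) i i = T.det := by simp [Matrix.adjugate_mul]
    rw [← hii, Matrix.mul_apply]
    exact Ideal.sum_mem _ fun j _ => Ideal.mul_mem_right _ _ (hT i j)
  obtain ⟨v, hv0, hv⟩ := (Matrix.exists_mulVec_eq_zero_iff
    (M := (IsLocalRing.residue R).mapMatrix T)).2 (by
      rwa [← RingHom.map_det, IsLocalRing.residue_eq_zero_iff])
  obtain ⟨w, rfl⟩ := IsLocalRing.residue_surjective.comp_left v
  obtain ⟨i, hi⟩ := Function.ne_iff.1 hv0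
  have hw : IsUnit (w i) := IsLocalRing.residue_ne_zero_iff_isUnit _ |>.1 hi
  have hTw (j : ι) : (T.mulVec w) j ∈ maximalIdeal R := by
    rw [← IsLocalRing.residue_eq_zero_iff, RingHom.map_mulVec]
    exact congrFun hv j
  have hadj : T.adjugate.mulVec (T.mulVec w) i = w i * T.det := by
    simp [Matrix.mulVec_mulVec, Matrix.adjugate_mul, Matrix.smul_mulVec, mul_comm]
  rw [← Ideal.unit_mul_mem_iff_mem _ hw, ← hadj, pow_two]
  exact Ideal.sum_mem _ fun j _ => Ideal.mul_mem_mul (hT i j) (hTw j)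

section Symmetric

variable {A B σ : Type*} [CommRing A] [CommRing B] [Algebra A B] [Fintype σ] {x : σ → B} {g : A[X]}

theorem aeval_esymm_mem_bot (hg : g.map (algebraMap A B) = ∏ i, (X - C (x i))) (k : ℕ) :
    MvPolynomial.aeval x (MvPolynomial.esymm σ A k) ∈ (⊥ : Subalgebra A B) := by
  rw [MvPolynomial.aeval_esymm_eq_multiset_esymm]
  rcases le_or_gt k (Fintype.card σ) with hk | hk
  · have hcoeff := (Finset.univ.val.map x).prod_X_sub_C_coeff
      (k := Fintype.card σ - k) (by simp)
    rw [Multiset.map_map, ← Finset.prod_eq_multiset_prod] at hcoeff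
    simp only [Function.comp_apply, ← hg, coeff_map, Multiset.card_map, Finset.card_val,
      Finset.card_univ, Nat.sub_sub_self hk] at hcoeff
    have hesymm : (Finset.univ.val.map x).esymm k =
        (-1) ^ k * algebraMap A B (g.coeff (Fintype.card σ - k)) := by
      rw [hcoeff, ← mul_assoc, ← mul_pow, neg_mul_neg, one_mul, one_pow, one_mul]
    rw [hesymm]
    exact mul_mem (pow_mem (neg_mem (one_mem _)) k) (Subalgebra.algebraMap_mem _ _)
  · simp [Multiset.esymm, Multiset.powersetCard_eq_empty k (s := Finset.univ.val.map x) (by simpa)]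

theorem aeval_mem_bot_of_isSymmetric (hg : g.map (algebraMap A B) = ∏ i, (X - C (x i)))
    {P : MvPolynomial σ A} (hP : P.IsSymmetric) :
    MvPolynomial.aeval x P ∈ (⊥ : Subalgebra A B) := by
  obtain ⟨Q, hQ⟩ := MvPolynomial.esymmAlgHom_surjective A le_rfl ⟨P, hP⟩
  have hPQ : MvPolynomial.aeval (fun i : Fin _ => MvPolynomial.esymm σ A (i + 1)) Q = P := by
    rw [← MvPolynomial.esymmAlgHom_apply, hQ]
  rw [← hPQ, ← AlgHom.comp_apply, MvPolynomial.comp_aeval]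
  refine MvPolynomial.eval₂_mem (fun _ _ => ?_) fun i => aeval_esymm_mem_bot hg _
  exact Subalgebra.algebraMap_mem _ _

end Symmetric

section Hankel

variable {A B : Type*} [CommRing A] [CommRing B] [Algebra A B] {n : ℕ} {x : Fin n → B} {g : A[X]}

open Matrix (vandermonde)

theorem exists_matrix_map_eq_transpose_vandermonde_mul
    (hg : g.map (algebraMap A B) = ∏ i, (X - C (x i))) :
    ∃ T : Matrix (Fin n) (Fin n) A,
      T.map (algebraMap A B) = (vandermonde x).transpose * vandermonde x := by
  have hpsum (m : ℕ) : ∃ c : A, algebraMap A B c = ∑ i, x i ^ m := by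
    simpa [MvPolynomial.psum, Algebra.mem_bot] using
      aeval_mem_bot_of_isSymmetric hg (MvPolynomial.psum_isSymmetric (Fin n) A m)
  choose c hc using hpsum
  refine ⟨Matrix.of fun i j => c (i + j), ?_⟩
  ext i j
  simp [Matrix.mul_apply, hc, Matrix.vandermonde_apply, pow_add]

theorem adjugate_vandermonde_eq_zero {R : Type*} [CommRing R] {y : Fin n → R} (i : Fin n)
    {j : Fin n} (hy : ¬ Set.InjOn y {j}ᶜ) : (vandermonde y).adjugate i j = 0 := by
  simp only [Set.InjOn, not_forall] at hy
  obtain ⟨k, hk, l, hl, hkl, hne⟩ := hy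
  rw [Matrix.adjugate_apply]
  refine Matrix.det_zero_of_row_eq hne (funext fun m => ?_)
  simp [Matrix.updateRow_ne hk, Matrix.updateRow_ne hl, Matrix.vandermonde_apply, hkl]

theorem not_injOn_compl_singleton {α β : Type*} [LinearOrder α] {y : α → β}
    {s t : {p : α × α // p.1 < p.2}} (hst : s ≠ t) (hs : y s.1.1 = y s.1.2)
    (ht : y t.1.1 = y t.1.2) (j : α) : ¬ Set.InjOn y {j}ᶜ := by
  obtain ⟨⟨a, b⟩, hab⟩ := s
  obtain ⟨⟨c, d⟩, hcd⟩ := t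
  intro h
  have hinj : ∀ k l, y k = y l → k = l ∨ k = j ∨ l = j := fun k l hkl => by
    by_contra! hne
    exact hne.1 (h hne.2.1 hne.2.2 hkl)
  have hswap : ¬ (a = d ∧ b = c) := fun ⟨had, hbc⟩ => lt_asymm hab (had ▸ hbc ▸ hcd)
  have hab_ne : a ≠ b := hab.ne
  have hcd_ne : c ≠ d := hcd.ne
  simp only [ne_eq, Subtype.mk.injEq, Prod.mk.injEq] at hst hs ht
  grind

theorem algebraMap_adjugate_mem {T : Matrix (Fin n) (Fin n) A} {q : Ideal B}
    (hT : T.map (algebraMap A B) = (vandermonde x).transpose * vandermonde x)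
    (hx : ∀ j, ¬ Set.InjOn (Ideal.Quotient.mk q ∘ x) {j}ᶜ) (i j : Fin n) :
    algebraMap A B (T.adjugate i j) ∈ q := by
  have hV : (Ideal.Quotient.mk q).mapMatrix (vandermonde x) =
      vandermonde (Ideal.Quotient.mk q ∘ x) := by
    ext; simp [Matrix.vandermonde_apply]
  have hadj : algebraMap A B (T.adjugate i j) =
      ((vandermonde x).adjugate * (vandermonde x).adjugate.transpose) i j := by
    rw [Matrix.adjugate_transpose, ← Matrix.adjugate_mul_distrib, ← hT]
    exact congrFun₂ ((algebraMap A B).map_adjugate T) i j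
  rw [hadj, Matrix.mul_apply]
  refine Ideal.sum_mem _ fun k _ => Ideal.mul_mem_right _ _ ?_
  rw [← Ideal.Quotient.eq_zero_iff_mem]
  refine Eq.trans ?_ (adjugate_vandermonde_eq_zero i (hx k))
  rw [← hV, ← RingHom.map_adjugate]
  rfl

end Hankel

section Loci

variable {A : Type u} [CommRing A] {n : ℕ} {a : ℕ → A}

theorem algebraMap_discr_halfPoly [Nontrivial (SSplit n a)] (ha : a 0 = 1) :
    algebraMap A (SSplit n a) (halfPoly n a).discr =
      ∏ i, ∏ j ∈ Finset.Ioi i, (eta n a i ^ 2 - eta n a j ^ 2) ^ 2 := by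
  rw [← discr_map_of_monic _ (halfPoly_monic n a ha), map_halfPoly, discr_prod_X_sub_C]

theorem algebraMap_constantCoeff : algebraMap A (SSplit n a) (a (2 * n)) =
    (-1) ^ n * ∏ i, eta n a i ^ 2 := by
  have hcoeff : (halfPoly n a).coeff 0 = a (2 * n) := by
    simp [halfPoly, coeff_X_pow, Finset.sum_range_succ']
  rw [← hcoeff, ← coeff_map, map_halfPoly, coeff_zero_eq_eval_zero, eval_prod]
  simp [Finset.prod_neg]

theorem det_eq_discr_halfPoly (ha : a 0 = 1) [Nontrivial (SSplit n a)]
    {T : Matrix (Fin n) (Fin n) A} (hT : T.map (algebraMap A (SSplit n a)) =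
      (Matrix.vandermonde fun i => eta n a i ^ 2).transpose *
        Matrix.vandermonde fun i => eta n a i ^ 2) : T.det = (halfPoly n a).discr := by
  have := (free_and_finite n ha).1
  apply FaithfulSMul.algebraMap_injective A (SSplit n a)
  rw [RingHom.map_det, RingHom.mapMatrix_apply, hT, Matrix.det_mul, Matrix.det_transpose,
    Matrix.det_vandermonde, algebraMap_discr_halfPoly ha, ← pow_two]
  simp only [← Finset.prod_pow]
  exact Finset.prod_congr rfl fun i _ => Finset.prod_congr rfl fun j _ => by ring

section AtPrime

variable {q : Ideal (SSplit n a)} [hq : q.IsPrime]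

theorem algebraMap_constantCoeff_mem {i : Fin n} (hi : coincidence n a (.inl i) ∈ q) :
    algebraMap A (SSplit n a) (a (2 * n)) ∈ q := by
  rw [algebraMap_constantCoeff]
  exact Ideal.mul_mem_left _ _
    (hq.prod_mem_iff.2 ⟨i, Finset.mem_univ i, q.pow_mem_of_mem hi 2 two_pos⟩)

theorem algebraMap_discr_halfPoly_mem (ha : a 0 = 1) {s : {p : Fin n × Fin n // p.1 < p.2}}
    (hs : coincidence n a (.inr s) ∈ q) : algebraMap A (SSplit n a) (halfPoly n a).discr ∈ q := by
  have : Nontrivial (SSplit n a) := nontrivial_of_ne 1 0 fun h => hq.one_notMem (h ▸ q.zero_mem)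
  rw [algebraMap_discr_halfPoly ha]
  exact hq.prod_mem_iff.2 ⟨s.1.1, Finset.mem_univ _,
    hq.prod_mem_iff.2 ⟨s.1.2, Finset.mem_Ioi.2 s.2, q.pow_mem_of_mem hs 2 two_pos⟩⟩

theorem algebraMap_Delta_mem_sq_of_inl_of_inr (ha : a 0 = 1) {i : Fin n}
    (hi : coincidence n a (.inl i) ∈ q) {s : {p : Fin n × Fin n // p.1 < p.2}}
    (hs : coincidence n a (.inr s) ∈ q) :
    algebraMap A (Localization.AtPrime (q.comap (algebraMap A (SSplit n a)))) (Delta n a) ∈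
      maximalIdeal (Localization.AtPrime (q.comap (algebraMap A (SSplit n a)))) ^ 2 := by
  rw [Delta, mul_assoc, map_mul, map_mul, pow_two]
  refine Ideal.mul_mem_left _ _ (Ideal.mul_mem_mul ?_ ?_) <;>
    rw [IsLocalization.AtPrime.to_map_mem_maximal_iff _ (q.comap (algebraMap A (SSplit n a)))]
  exacts [algebraMap_constantCoeff_mem hi, algebraMap_discr_halfPoly_mem ha hs]

theorem algebraMap_Delta_mem_sq_of_inr_of_inr (ha : a 0 = 1)
    {s t : {p : Fin n × Fin n // p.1 < p.2}} (hst : s ≠ t)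
    (hs : coincidence n a (.inr s) ∈ q) (ht : coincidence n a (.inr t) ∈ q) :
    algebraMap A (Localization.AtPrime (q.comap (algebraMap A (SSplit n a)))) (Delta n a) ∈
      maximalIdeal (Localization.AtPrime (q.comap (algebraMap A (SSplit n a)))) ^ 2 := by
  have : Nontrivial (SSplit n a) := nontrivial_of_ne 1 0 fun h => hq.one_notMem (h ▸ q.zero_mem)
  have : Nonempty (Fin n) := ⟨s.1.1⟩
  obtain ⟨T, hT⟩ := exists_matrix_map_eq_transpose_vandermonde_mul (map_halfPoly n a)
  rw [Delta, map_mul, ← det_eq_discr_halfPoly ha hT, RingHom.map_det]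
  refine Ideal.mul_mem_left _ _ (det_mem_maximalIdeal_sq _ fun i j => ?_)
  rw [← RingHom.map_adjugate, RingHom.mapMatrix_apply, Matrix.map_apply,
    IsLocalization.AtPrime.to_map_mem_maximal_iff _ (q.comap (algebraMap A (SSplit n a)))]
  exact algebraMap_adjugate_mem hT (not_injOn_compl_singleton hst (Ideal.Quotient.eq.2 hs)
    (Ideal.Quotient.eq.2 ht)) i j

end AtPrime

theorem lowerLocus_subset_secondOrderLocus (ha : a 0 = 1) :
    lowerLocus n a ⊆ secondOrderLocus (Delta n a) := by
  rintro _ ⟨q, ⟨s, t, hst, hs, ht⟩, rfl⟩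
  rcases s with i | s <;> rcases t with j | t
  · have hi2 : eta n a i ^ 2 ∈ q.asIdeal := q.asIdeal.pow_mem_of_mem hs 2 two_pos
    have hj2 : eta n a j ^ 2 ∈ q.asIdeal := q.asIdeal.pow_mem_of_mem ht 2 two_pos
    rcases lt_or_gt_of_ne (fun h => hst (congrArg _ h) : i ≠ j) with hij | hji
    · exact algebraMap_Delta_mem_sq_of_inl_of_inr ha hs (s := ⟨(i, j), hij⟩)
        (q.asIdeal.sub_mem hi2 hj2)
    · exact algebraMap_Delta_mem_sq_of_inl_of_inr ha hs (s := ⟨(j, i), hji⟩)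
        (q.asIdeal.sub_mem hj2 hi2)
  · exact algebraMap_Delta_mem_sq_of_inl_of_inr ha hs ht
  · exact algebraMap_Delta_mem_sq_of_inl_of_inr ha ht hs
  · exact algebraMap_Delta_mem_sq_of_inr_of_inr ha (fun h => hst (congrArg _ h)) hs ht

end Loci

/-! ### Normality of the signed splitting ring -/

variable {A : Type u} [CommRing A]

theorem primeOrder_eq_zero_or_one_iff {p : PrimeSpectrum A} {x : A} :
    primeOrder p x = 0 ∨ primeOrder p x = 1 ↔ p ∉ secondOrderLocus x := by
  have hle_one : primeOrder p x = 0 ∨ primeOrder p x = 1 ↔ primeOrder p x ≤ 1 :=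
    ⟨by rintro (h | h) <;> simp [h], fun h => h.lt_or_eq.imp_left Order.lt_one_iff.1⟩
  rw [hle_one]
  refine ⟨fun h hx => ?_, fun h => iSup₂_le fun k hk => ?_⟩
  · have htwo : (2 : ℕ∞) ≤ primeOrder p x :=
      le_iSup₂_of_le (f := fun (k : ℕ) _ => (k : ℕ∞)) 2 hx le_rfl
    exact absurd (htwo.trans h) (by decide)
  · by_contra hlt
    have hk2 : 2 ≤ k := by exact_mod_cast Order.add_one_le_of_lt (not_le.1 hlt)
    exact h (Ideal.pow_le_pow_right hk2 hk)

theorem CodimGE.notMem_of_height_eq_one {S : Set (PrimeSpectrum A)} (hS : CodimGE S 2)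
    {p : PrimeSpectrum A} (hp : p.asIdeal.height = 1) : p ∉ S := fun hpS =>
  absurd (hp ▸ hS p hpS) (by decide)

theorem isSquarefreeElt_of_codimGE_secondOrderLocus {x : A} (h : CodimGE (secondOrderLocus x) 2) :
    IsSquarefreeElt x := fun _ hp =>
  primeOrder_eq_zero_or_one_iff.2 (h.notMem_of_height_eq_one hp)

theorem isNormalRing_of_isSquarefreeElt [IsNoetherianRing A] {n : ℕ} {a : ℕ → A} (ha : a 0 = 1)
    (hA : IsNormalRing A) (hsq : IsSquarefreeElt (Delta n a)) (hΔ : Delta n a ∈ A⁰)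
    (hE : CodimGE (lowerLocus n a) 2) : IsNormalRing (SSplit n a) := by
  obtain ⟨_, _⟩ := free_and_finite n ha
  have hheight_one (Q : Ideal (SSplit n a)) [hQ : Q.IsPrime]
      (hheight : (Q.comap (algebraMap A (SSplit n a))).height = 1) :
      IsNormalDomain (Localization.AtPrime Q) := by
    let p := PrimeSpectrum.comap (algebraMap A (SSplit n a)) ⟨Q, hQ⟩
    have : Q.LiesOver p.asIdeal := ⟨rfl⟩
    refine isNormalDomain_localization_of_height_eq_one (p := p.asIdeal) ha hheight (hA p)
      (primeOrder_eq_zero_or_one_iff.1 (hsq p hheight)) Q fun s t hst hs ht => ?_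
    exact hE.notMem_of_height_eq_one (p := p) hheight ⟨⟨Q, hQ⟩, ⟨s, t, hst, hs, ht⟩, rfl⟩
  intro q
  exact isNormalDomain_localization_of_forall_height_eq_one (fun p hp => hA ⟨p, hp⟩) hΔ
    (Delta_smul_kaehlerDifferential_eq_zero ha) hheight_one q.asIdeal

end SignedSplit

theorem mainTheorem4 {A : Type*} [CommRing A] [IsNoetherianRing A]
    (n : ℕ) (a : ℕ → A) (ha : a 0 = 1) :
    -- the criterion in terms of the coincidence locus
    (SignedSplit.IsNormalRing A →
      SignedSplit.IsSquarefreeElt (SignedSplit.Delta n a) →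
      SignedSplit.Delta n a ∈ nonZeroDivisors A →
      SignedSplit.CodimGE (SignedSplit.lowerLocus n a) 2 →
        SignedSplit.IsNormalRing (SignedSplit.SSplit n a)) ∧
    -- the variant in terms of the second-order vanishing locus
    (SignedSplit.IsNormalRing A →
      SignedSplit.Delta n a ∈ nonZeroDivisors A →
      SignedSplit.CodimGE (SignedSplit.secondOrderLocus (SignedSplit.Delta n a)) 2 →
        SignedSplit.IsSquarefreeElt (SignedSplit.Delta n a) ∧
        SignedSplit.IsNormalRing (SignedSplit.SSplit n a)) := by
  refine ⟨fun hA hsq hΔ hE => SignedSplit.isNormalRing_of_isSquarefreeElt ha hA hsq hΔ hE,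
    fun hA hΔ hV => ?_⟩
  have hsq := SignedSplit.isSquarefreeElt_of_codimGE_secondOrderLocus hV
  have hE : SignedSplit.CodimGE (SignedSplit.lowerLocus n a) 2 := fun p hp =>
    hV p (SignedSplit.lowerLocus_subset_secondOrderLocus ha hp)
  exact ⟨hsq, SignedSplit.isNormalRing_of_isSquarefreeElt ha hA hsq hΔ hE⟩
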